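/- Let $(M,g)$ be a smooth compact Riemannian manifold without boundary, of dimension $n$. For $m\ge 0$ let $S^m$ be the bundle of symmetric covariant tensors of rank $m$ (real or complex valued) and $C^\infty(S^m)$ the space of its smooth sections; put $S^{m}=0$ for $m<0$. Let $\sigma$ be the symmetrization and $\nabla$ the Levi-Civita covariant derivative, and define - $d=\sigma\nabla: C^\infty(S^m)\to C^\infty(S^{m+1})$ and $\delta: C^\infty(S^{m+1})\to C^\infty(S^{m})$, $(\delta f)_{i_1\dots i_m}=g^{pq}\nabla_{p}f_{q i_1\dots i_m}$; - $i: S^m\to S^{m+2}$, $if=\sigma(f\otimes g)$, and $j:S^{m+2}\to S^m$, $(jf)_{i_1\dots i_m}=g^{pq}f_{pqi_1\dots i_m}$ (with $j=0$ on $S^0$ and $S^1$); - $p:S^m\to S^m$, the orthogonal projection (with respect to the scalar product induced by $g$) onto the subbundle $\mathrm{Ker}^m j=\{f\in S^m: jf=0\}$ of trace-free tensors. A field $f\in C^\infty(S^m)$ is a Killing tensor field if $df=0$; its higher harmonic is $pf$. A field $f\in C^\infty(S^m)$ is potential if $f=dv$ for some $v\in C^\infty(S^{m-1})$. For every $m\ge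 0$ the following holds. 1. Let $f$ be a Killing tensor field of rank $m$. A field $h$ of rank $m$ is a Killing tensor field with $ph=pf$ if and only if $h=f+iv$ for some Killing tensor field $v$ of rank $m-2$ (that is, $h=f$ if $m<2$). 2. A field $f\in C^\infty(\mathrm{Ker}^m j)$ is the higher harmonic of some Killing tensor field of rank $m$ if and only if $pdf=0$ and $\delta f$ is potential, i.e. $\delta f=dv$ for some $v\in C^\infty(S^{m-2})$ (that is, $\delta f=0$ if $m=1$, and no condition on $\delta f$ if $m=0$). -/

import Mathlib

open Bundle Manifold
open scoped ContDiff

noncomputable section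

namespace KillingTensor

/-! ### Algebra of covariant tensors on a finite-dimensional Euclidean space `V`

The coefficient field `𝕜` is `ℝ` (real tensors) or `ℂ` (complex-valued tensors). -/

section Algebra

variable (𝕜 : Type*) [RCLike 𝕜] (m : ℕ) (V : Type*) [NormedAddCommGroup V]
  [InnerProductSpace ℝ V]

/-- Covariant tensors of rank `m` on `V`. -/
abbrev CovTensor : Type _ := ContinuousMultilinearMap ℝ (fun _ : Fin m => V) 𝕜

variable {𝕜 m V}

/-- The tensor is symmetric, i.e. belongs to `S^m`. -/
def IsSymm (f : CovTensor 𝕜 m V) : Prop :=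
  ∀ (s : Equiv.Perm (Fin m)) (v : Fin m → V), f (fun a => v (s a)) = f v

/-- The symmetrization `σ`. -/
def symmetrize (f : CovTensor 𝕜 m V) : CovTensor 𝕜 m V :=
  ((Nat.factorial m : ℝ)⁻¹) • ∑ s : Equiv.Perm (Fin m), f.domDomCongr s

/-- The product of a tensor `f` of rank `m` with the metric tensor, before symmetrization:
`(w₀, w₁, …, wₘ₊₁) ↦ ⟨w₀, w₁⟩ f(w₂, …, wₘ₊₁)`. -/
def metricMul (f : CovTensor 𝕜 m V) : CovTensor 𝕜 (m + 2) V :=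
  ContinuousLinearMap.uncurryLeft
    ((continuousMultilinearCurryLeftEquiv ℝ (fun _ : Fin (m + 1) => V)
        𝕜).symm.toContinuousLinearEquiv.toContinuousLinearMap.comp
      (((ContinuousLinearMap.smulRightL ℝ V (CovTensor 𝕜 m V)).flip f).comp (innerSL ℝ)))

theorem metricMul_apply (f : CovTensor 𝕜 m V) (w : Fin (m + 2) → V) :
    metricMul f w = (inner ℝ (w 0) (w 1) : ℝ) • f (fun a => w a.succ.succ) := rfl

/-- The operator `i : S^m → S^{m+2}` of symmetric multiplication by the metric tensor. -/
def iOp (f : CovTensor 𝕜 m V) : CovTensor 𝕜 (m + 2) V := symmetrize (metricMul f)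

variable [FiniteDimensional ℝ V]

/-- The contraction of the first two arguments with the metric,
`(v₁, …, vₘ) ↦ g^{pq} f_{pq}(v₁, …, vₘ)`, computed in an orthonormal basis.
On symmetric tensors this is the operator `j`. -/
def jOp (f : CovTensor 𝕜 (m + 2) V) : CovTensor 𝕜 m V :=
  ∑ a, (f.curryLeft (stdOrthonormalBasis ℝ V a)).curryLeft (stdOrthonormalBasis ℝ V a)

/-- The trace `jf` vanishes; there is no condition in ranks `0` and `1`. -/
def TraceZero : {m : ℕ} → CovTensor 𝕜 m V → Prop
  | 0, _ => True
  | 1, _ => True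
  | _ + 2, f => jOp f = 0

/-- The components of a tensor with respect to an orthonormal basis. -/
def components : CovTensor 𝕜 m V →ₗ[𝕜]
    EuclideanSpace 𝕜 (Fin m → Fin (Module.finrank ℝ V)) where
  toFun f := WithLp.toLp 2 fun J => f (fun a => stdOrthonormalBasis ℝ V (J a))
  map_add' f h := by ext; simp
  map_smul' c f := by ext; simp

/-- The natural scalar product of tensors: the sum over multi-indices `J` of
`conj (f_J) * h_J` in an orthonormal basis. -/
def tensorInner (f h : CovTensor 𝕜 m V) : 𝕜 := inner 𝕜 (components f) (components h)

variable (𝕜 m V) in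
/-- The space `Ker^m j` of symmetric trace-free tensors. -/
def kerJ : Submodule 𝕜 (CovTensor 𝕜 m V) where
  carrier := {f | IsSymm f ∧ TraceZero f}
  zero_mem' := by
    refine ⟨fun _ _ => rfl, ?_⟩
    match m with
    | 0 => trivial
    | 1 => trivial
    | m + 2 => exact Finset.sum_eq_zero fun _ _ => rfl
  add_mem' := by
    rintro f h ⟨hf, hf'⟩ ⟨hh, hh'⟩
    refine ⟨fun s v => by simp [hf s v, hh s v], ?_⟩
    match m with
    | 0 => trivial
    | 1 => trivial
    | m + 2 =>
      have : jOp (f + h) = jOp f + jOp h := by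
        ext v; simp [jOp, Finset.sum_add_distrib]
      change jOp (f + h) = 0
      rw [this, show jOp f = 0 from hf', show jOp h = 0 from hh', add_zero]
  smul_mem' := by
    rintro c f ⟨hf, hf'⟩
    refine ⟨fun s v => by simp [hf s v], ?_⟩
    match m with
    | 0 => trivial
    | 1 => trivial
    | m + 2 =>
      have : jOp (c • f) = c • jOp f := by
        ext v; simp [jOp, Finset.mul_sum]
      change jOp (c • f) = 0
      rw [this, show jOp f = 0 from hf']
      ext v; simp

theorem components_injective :
    Function.Injective (components : CovTensor 𝕜 m V →ₗ[𝕜] _) := by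
  intro f h hfh
  apply ContinuousMultilinearMap.toMultilinearMap_injective
  refine Module.Basis.ext_multilinear (fun _ => (stdOrthonormalBasis ℝ V).toBasis) fun J => ?_
  simpa [components] using congrArg (fun t => t J) hfh

/-- Existence and uniqueness of the orthogonal projection onto `Ker^m j`. -/
theorem existsUnique_projection (f : CovTensor 𝕜 m V) :
    ∃! t : CovTensor 𝕜 m V, t ∈ kerJ 𝕜 m V ∧ ∀ k ∈ kerJ 𝕜 m V, tensorInner k (f - t) = 0 := by
  set K := (kerJ 𝕜 m V).map components with hK
  obtain ⟨t, ht, hc⟩ := Submodule.mem_map.1 (K.starProjection_apply_mem (components f))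
  refine ⟨t, ⟨ht, fun k hk => ?_⟩, ?_⟩
  · rw [tensorInner, map_sub, hc]
    exact (K.mem_orthogonal _).1 (K.sub_starProjection_mem_orthogonal _) _
      (Submodule.mem_map_of_mem hk)
  · rintro t' ⟨ht', hort⟩
    apply components_injective
    rw [hc]
    refine (K.eq_starProjection_of_mem_of_inner_eq_zero (Submodule.mem_map_of_mem ht') ?_).symm
    rintro w hw
    obtain ⟨k, hk, rfl⟩ := Submodule.mem_map.1 hw
    rw [← map_sub, inner_eq_zero_symm]
    exact hort k hk

/-- The operator `p`: the orthogonal projection onto the space `Ker^m j` of symmetric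
trace-free tensors. -/
def pOp (f : CovTensor 𝕜 m V) : CovTensor 𝕜 m V := (existsUnique_projection f).choose

end Algebra

/-! ### Tensor fields on a Riemannian manifold -/

section Fields

variable {n : ℕ} {M : Type*} [TopologicalSpace M] [ChartedSpace (EuclideanSpace ℝ (Fin n)) M]

/-- The differential at `u` of the inverse of the preferred chart around `c`; it sends the
`k`-th basis vector of `ℝⁿ` to the coordinate vector field `∂/∂xᵏ`. -/
def coordFrame (c : M) (u : EuclideanSpace ℝ (Fin n)) :
    EuclideanSpace ℝ (Fin n) →L[ℝ] TangentSpace (𝓡 n) ((extChartAt (𝓡 n) c).symm u) :=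
  mfderiv (𝓡 n) (𝓡 n) (extChartAt (𝓡 n) c).symm u

/-- The differential at `x` of the preferred chart around `x`. -/
def chartDifferential (x : M) : TangentSpace (𝓡 n) x →L[ℝ] EuclideanSpace ℝ (Fin n) :=
  mfderiv (𝓡 n) (𝓡 n) (extChartAt (𝓡 n) x) x

variable [RiemannianBundle (fun x : M => TangentSpace (𝓡 n) x)]

/-- The components `g_{ij}` of the metric tensor in the chart around `c`. -/
def metricCoeff (c : M) (u : EuclideanSpace ℝ (Fin n)) : Matrix (Fin n) (Fin n) ℝ :=
  Matrix.of fun i j => inner ℝ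
    (coordFrame c u (EuclideanSpace.single i 1)) (coordFrame c u (EuclideanSpace.single j 1))

/-- The partial derivative `∂g_{ij}/∂xᵏ` in the chart around `c`. -/
def metricDeriv (c : M) (u : EuclideanSpace ℝ (Fin n)) (k i j : Fin n) : ℝ :=
  fderiv ℝ (fun u' => metricCoeff c u' i j) u (EuclideanSpace.single k 1)

/-- The Christoffel symbol `Γᵏ_{ij}` of the Levi-Civita connection in the chart around `c`. -/
def christoffel (c : M) (u : EuclideanSpace ℝ (Fin n)) (k i j : Fin n) : ℝ :=
  (1 / 2) * ∑ l, (metricCoeff c u)⁻¹ k l *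
    (metricDeriv c u i j l + metricDeriv c u j i l - metricDeriv c u l i j)

/-- The Christoffel symbols as a bilinear map, `(w, v) ↦ Γᵏ_{ij} wⁱ vʲ eₖ`. -/
def christoffelMap (c : M) (u : EuclideanSpace ℝ (Fin n)) :
    EuclideanSpace ℝ (Fin n) →L[ℝ] EuclideanSpace ℝ (Fin n) →L[ℝ] EuclideanSpace ℝ (Fin n) :=
  ∑ k, ∑ i, ∑ j, christoffel c u k i j •
    (EuclideanSpace.proj (𝕜 := ℝ) i).smulRight
      ((EuclideanSpace.proj (𝕜 := ℝ) j).smulRight (EuclideanSpace.single k (1 : ℝ)))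

variable (𝕜 : Type*) [RCLike 𝕜] (n M) (m : ℕ)

/-- Fields of covariant tensors of rank `m` on `M` (not necessarily smooth or symmetric). -/
abbrev TensorField : Type _ := (x : M) → CovTensor 𝕜 m (TangentSpace (𝓡 n) x)

variable {𝕜 n M m}

/-- The tensor field read in the chart around `c`: a function on (an open subset of) `ℝⁿ`
with values in the rank `m` covariant tensors on `ℝⁿ`. -/
def inChart (f : TensorField n M 𝕜 m) (c : M) (u : EuclideanSpace ℝ (Fin n)) :
    CovTensor 𝕜 m (EuclideanSpace ℝ (Fin n)) :=
  (f ((extChartAt (𝓡 n) c).symm u)).compContinuousLinearMap (fun _ => coordFrame c u)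

theorem inChart_apply (f : TensorField n M 𝕜 m) (c : M) (u : EuclideanSpace ℝ (Fin n))
    (v : Fin m → EuclideanSpace ℝ (Fin n)) :
    inChart f c u v = f ((extChartAt (𝓡 n) c).symm u) (fun a => coordFrame c u (v a)) := rfl

/-- `f` belongs to `C^∞(S^m)`: it is symmetric and its components in local coordinates are
smooth. -/
structure IsSmoothSymm (f : TensorField n M 𝕜 m) : Prop where
  symm : ∀ x, IsSymm (f x)
  smooth : ∀ c : M, ContDiffOn ℝ ∞ (inChart f c) (extChartAt (𝓡 n) c).target

/-- The covariant derivative in the chart around `c`,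
`(∇f)(w, v₁, …, vₘ) = (∂_w f)(v₁, …, vₘ) - ∑ₛ f(v₁, …, Γ(w, vₛ), …, vₘ)`. -/
def nablaInChart (f : TensorField n M 𝕜 m) (c : M) (u : EuclideanSpace ℝ (Fin n)) :
    EuclideanSpace ℝ (Fin n) →L[ℝ] CovTensor 𝕜 m (EuclideanSpace ℝ (Fin n)) :=
  fderiv ℝ (inChart f c) u -
    ∑ s : Fin m, (ContinuousLinearMap.apply ℝ _ (inChart f c u)).comp
      (((ContinuousMultilinearMap.compContinuousLinearMapContinuousMultilinear ℝ
          (fun _ : Fin m => EuclideanSpace ℝ (Fin n))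
          (fun _ : Fin m => EuclideanSpace ℝ (Fin n)) 𝕜).toContinuousLinearMap
        (fun _ => ContinuousLinearMap.id ℝ _) s).comp (christoffelMap c u))

theorem nablaInChart_apply (f : TensorField n M 𝕜 m) (c : M) (u w : EuclideanSpace ℝ (Fin n))
    (v : Fin m → EuclideanSpace ℝ (Fin n)) :
    nablaInChart f c u w v = fderiv ℝ (inChart f c) u w v -
      ∑ s, inChart f c u (Function.update v s (christoffelMap c u w (v s))) := by
  have key (s : Fin m) (L : EuclideanSpace ℝ (Fin n) →L[ℝ] EuclideanSpace ℝ (Fin n)) :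
      (fun a => Function.update (fun _ => ContinuousLinearMap.id ℝ _) s L a (v a)) =
        Function.update v s (L (v s)) := by
    funext a
    by_cases h : a = s
    · subst h; simp
    · simp [Function.update_of_ne, h]
  simp [nablaInChart, key]

/-- The covariant derivative `∇f` with respect to the Levi-Civita connection, a field of
tensors of rank `m + 1` whose first argument is the direction of differentiation. At `x` it is
computed in the chart around `x` and carried to the tangent space by the differential of the
chart. -/
def nabla (f : TensorField n M 𝕜 m) : TensorField n M 𝕜 (m + 1) := fun x =>
  (nablaInChart f x (extChartAt (𝓡 n) x x)).uncurryLeft.compContinuousLinearMap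
    (fun _ => chartDifferential x)

theorem nabla_apply (f : TensorField n M 𝕜 m) (x : M)
    (v : Fin (m + 1) → TangentSpace (𝓡 n) x) :
    nabla f x v = nablaInChart f x (extChartAt (𝓡 n) x x)
      (chartDifferential x (v 0))
      (fun a => chartDifferential x (v a.succ)) := rfl

instance (x : M) : FiniteDimensional ℝ (TangentSpace (𝓡 n) x) :=
  inferInstanceAs (FiniteDimensional ℝ (EuclideanSpace ℝ (Fin n)))

/-- The inner differentiation `d = σ∇`. -/
def dOp (f : TensorField n M 𝕜 m) : TensorField n M 𝕜 (m + 1) :=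
  fun x => symmetrize (nabla f x)

/-- The divergence `(δf)_{i₁…iₘ} = g^{pq} ∇_p f_{q i₁…iₘ}`. -/
def divergence (f : TensorField n M 𝕜 (m + 1)) : TensorField n M 𝕜 m :=
  fun x => jOp (nabla f x)

/-- Killing tensor fields: fields `f ∈ C^∞(S^m)` with `df = 0`. -/
def IsKilling (f : TensorField n M 𝕜 m) : Prop := IsSmoothSymm f ∧ dOp f = 0

/-- The higher harmonic `pf` of a tensor field. -/
def higherHarmonic (f : TensorField n M 𝕜 m) : TensorField n M 𝕜 m := fun x => pOp (f x)

/-- `f` belongs to `C^∞(Ker^m j)`. -/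
def IsSmoothTraceFree (f : TensorField n M 𝕜 m) : Prop :=
  IsSmoothSymm f ∧ ∀ x, TraceZero (f x)

/-- `f = iv` for some Killing field `v` of rank `m - 2`; a tensor field of negative rank
is zero. -/
def IsMetricTimesKilling : {m : ℕ} → TensorField n M 𝕜 m → Prop
  | 0, f => f = 0
  | 1, f => f = 0
  | m + 2, f => ∃ v : TensorField n M 𝕜 m, IsKilling v ∧ f = fun x => iOp (v x)

/-- `f` is potential: `f = dv` for some `v ∈ C^∞(S^{m-1})`; a tensor field of negative rank
is zero. -/
def IsPotential : {m : ℕ} → TensorField n M 𝕜 m → Prop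
  | 0, f => f = 0
  | m + 1, f => ∃ v : TensorField n M 𝕜 m, IsSmoothSymm v ∧ f = dOp v

/-- The divergence `δf` is potential; there is no condition for `m = 0`, where `δf` has
negative rank. -/
def HasPotentialDivergence : {m : ℕ} → TensorField n M 𝕜 m → Prop
  | 0, _ => True
  | _ + 1, f => IsPotential (divergence f)

end Fields

end KillingTensor

end

/-!
A symmetric tensor `F` is determined by the polynomial `x ↦ F(x, …, x)`. In these terms `i` is
multiplication by `‖x‖²` and `j` is a multiple of the Laplacian, so `i` is injective on tensors of
positive rank, and the product rule for the Laplacian shows that `j(iv)` is a multiple of `v` for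
trace-free `v`, and `j(df)` a multiple of `δf` for trace-free `f`. As `i` and `j` are adjoint,
every symmetric tensor `F` is `pF + iv`; hence two fields with the same higher harmonic differ by
a field `iv`, and for trace-free `f` of rank at least 2 the equation `pdf = 0` means
`df = c • iδf` with an explicit constant `c ≠ 0`.

The metric is parallel, so `∇` commutes with `i` and preserves trace-freeness. Therefore
`d(f + iv) = df + i(dv)`, and by injectivity of `i`, if `f` is Killing then `f + iv` is Killing
exactly when `v` is. If `f` is trace-free, then `d(f - c • iv) = 0` exactly when `pdf = 0` and
`δf = dv`.

That the metric is parallel is used in the chart around a point: vectors moved along a straight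
line by the Christoffel symbols at its starting point have inner products which are constant to
the first order.
-/

noncomputable section

namespace KillingTensor

open InnerProductSpace Laplacian

section SymmetricTensors

variable {𝕜 : Type*} [RCLike 𝕜] {m : ℕ} {V : Type*} [NormedAddCommGroup V]
  [InnerProductSpace ℝ V]

variable (𝕜 m V) in
/-- The space `S^m` of symmetric tensors of rank `m`. -/
def symTensor : Submodule 𝕜 (CovTensor 𝕜 m V) where
  carrier := {F | IsSymm F}
  add_mem' hF hG s v := by simp [hF s v, hG s v]
  zero_mem' _ _ := rfl
  smul_mem' c F hF s v := by simp [show F _ = F v from hF s v]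

/-- The homogeneous polynomial `x ↦ F(x, …, x)` attached to a tensor. On symmetric tensors it
turns the operator `i` into multiplication by `‖x‖²` and `j` into a multiple of the Laplacian. -/
def diag (F : CovTensor 𝕜 m V) (x : V) : 𝕜 := F fun _ => x

theorem IsSymm.curryLeft {F : CovTensor 𝕜 (m + 1) V} (hF : IsSymm F) (e : V) :
    IsSymm (F.curryLeft e) := by
  intro s v
  have h := hF (Equiv.Perm.decomposeFin.symm (0, s)) (Fin.cons e v)
  rw [ContinuousMultilinearMap.curryLeft_apply, ContinuousMultilinearMap.curryLeft_apply, ← h]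
  congr 1
  funext a
  refine Fin.cases ?_ (fun a => ?_) a <;> simp

theorem IsSymm.update_const {F : CovTensor 𝕜 (m + 1) V} (hF : IsSymm F) (x e : V)
    (s : Fin (m + 1)) :
    F (Function.update (fun _ => x) s e) = diag (F.curryLeft e) x := by
  rw [diag, ContinuousMultilinearMap.curryLeft_apply,
    ← hF (Equiv.swap 0 s) (Fin.cons e fun _ => x)]
  congr 1
  funext a
  rcases eq_or_ne a s with rfl | has
  · simp
  · have h0 : Equiv.swap 0 s a ≠ 0 := fun h => has <| by
      simpa using congrArg (Equiv.swap 0 s) h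
    obtain ⟨b, hb⟩ := Fin.exists_succ_eq.2 h0
    rw [Function.update_of_ne has, ← hb, Fin.cons_succ]

theorem contDiff_diag (F : CovTensor 𝕜 m V) {k : WithTop ℕ∞} : ContDiff ℝ k (diag F) :=
  F.contDiff.comp (contDiff_pi.2 fun _ => contDiff_id)

theorem fderiv_diag (F : CovTensor 𝕜 m V) (x e : V) :
    fderiv ℝ (diag F) x e = ∑ s, F (Function.update (fun _ => x) s e) := by
  have hconst : HasFDerivAt (fun y : V => fun _ : Fin m => y)
      (ContinuousLinearMap.pi fun _ => ContinuousLinearMap.id ℝ V) x :=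
    hasFDerivAt_pi.2 fun _ => hasFDerivAt_id x
  rw [show diag F = F ∘ fun y _ => y from rfl, ((F.hasFDerivAt _).comp x hconst).fderiv]
  simp [ContinuousMultilinearMap.linearDeriv_apply]

theorem IsSymm.fderiv_diag {F : CovTensor 𝕜 (m + 1) V} (hF : IsSymm F) (x e : V) :
    fderiv ℝ (diag F) x e = (m + 1) • diag (F.curryLeft e) x := by
  simp [KillingTensor.fderiv_diag, hF.update_const]

theorem fderiv_diag_self (F : CovTensor 𝕜 m V) (x : V) :
    fderiv ℝ (diag F) x x = m • diag F x := by
  simp [fderiv_diag, diag]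

theorem IsSymm.eq_zero_of_diag_eq_zero {F : CovTensor 𝕜 m V} (hF : IsSymm F)
    (h : diag F = 0) : F = 0 := by
  induction m with
  | zero =>
    ext v
    simpa [diag, Subsingleton.elim v fun _ => 0] using congrFun h 0
  | succ m ih =>
    have hcurry (e : V) : F.curryLeft e = 0 := by
      refine ih (hF.curryLeft e) (funext fun x => ?_)
      simpa [h, m.cast_add_one_ne_zero] using hF.fderiv_diag x e
    ext v
    simpa [ContinuousMultilinearMap.curryLeft_apply] using
      congrArg (fun T => T (Fin.tail v)) (hcurry (v 0))

theorem IsSymm.ext_diag {F G : CovTensor 𝕜 m V} (hF : IsSymm F) (hG : IsSymm G)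
    (h : ∀ x, diag F x = diag G x) : F = G :=
  sub_eq_zero.1 <| eq_zero_of_diag_eq_zero ((symTensor 𝕜 m V).sub_mem hF hG) <|
    funext fun x => sub_eq_zero.2 (h x)

theorem IsSymm.curryLeft_comm {F : CovTensor 𝕜 (m + 2) V} (hF : IsSymm F) (e e' : V) :
    (F.curryLeft e).curryLeft e' = (F.curryLeft e').curryLeft e := by
  ext v
  simp only [ContinuousMultilinearMap.curryLeft_apply]
  rw [← hF (Equiv.swap 0 1)]
  congr 1
  funext a
  refine Fin.cases (by simp) (Fin.cases (by simp) fun a => ?_) a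
  rw [Equiv.swap_apply_of_ne_of_ne (Fin.succ_ne_zero _) (by simp [Fin.ext_iff])]
  simp

theorem diag_curryLeft_self (F : CovTensor 𝕜 (m + 1) V) (x : V) :
    diag (F.curryLeft x) x = diag F x :=
  congrArg F (funext fun a => Fin.cases rfl (fun _ => rfl) a)

theorem symmetrize_apply (F : CovTensor 𝕜 m V) (v : Fin m → V) :
    symmetrize F v =
      ((Nat.factorial m : ℝ)⁻¹) • ∑ s : Equiv.Perm (Fin m), F (fun a => v (s a)) := by
  simp [symmetrize]

theorem isSymm_symmetrize (F : CovTensor 𝕜 m V) : IsSymm (symmetrize F) := by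
  intro s v
  rw [symmetrize_apply, symmetrize_apply]
  congr 1
  exact Fintype.sum_equiv (Equiv.mulLeft s) _ _ fun _ => rfl

theorem diag_symmetrize (F : CovTensor 𝕜 m V) (x : V) : diag (symmetrize F) x = diag F x := by
  have : (m.factorial : ℝ) ≠ 0 := mod_cast m.factorial_ne_zero
  rw [diag, symmetrize_apply, Finset.sum_const, Finset.card_univ, Fintype.card_perm,
    Fintype.card_fin, ← Nat.cast_smul_eq_nsmul ℝ, inv_smul_smul₀ this, diag]

theorem isLinearMap_symmetrize :
    IsLinearMap 𝕜 (symmetrize : CovTensor 𝕜 m V → CovTensor 𝕜 m V) where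
  map_add F G := by ext v; simp [symmetrize_apply, Finset.sum_add_distrib]
  map_smul c F := by ext v; simp [symmetrize_apply, ← Finset.mul_sum]

theorem isSymm_iOp (F : CovTensor 𝕜 m V) : IsSymm (iOp F) := isSymm_symmetrize _

theorem diag_iOp (F : CovTensor 𝕜 m V) (x : V) : diag (iOp F) x = ‖x‖ ^ 2 • diag F x := by
  rw [iOp, diag_symmetrize, diag, metricMul_apply, real_inner_self_eq_norm_sq, diag]

theorem isLinearMap_iOp : IsLinearMap 𝕜 (iOp : CovTensor 𝕜 m V → CovTensor 𝕜 (m + 2) V) where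
  map_add F G := by
    rw [iOp, iOp, iOp, ← isLinearMap_symmetrize.map_add]
    congr 1
    ext w
    simp [metricMul_apply]
  map_smul c F := by
    rw [iOp, iOp, ← isLinearMap_symmetrize.map_smul]
    congr 1
    ext w
    simp [metricMul_apply]

theorem iOp_sub (F G : CovTensor 𝕜 m V) : iOp (F - G) = iOp F - iOp G :=
  isLinearMap_iOp.map_sub F G

theorem IsSymm.eq_zero_of_iOp_eq_zero {F : CovTensor 𝕜 (m + 1) V} (hF : IsSymm F)
    (h : iOp F = 0) : F = 0 := by
  refine hF.eq_zero_of_diag_eq_zero (funext fun x => ?_)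
  rcases eq_or_ne x 0 with rfl | hx
  · exact F.map_coord_zero 0 rfl
  · have hx' : ‖x‖ ^ 2 • diag F x = 0 := by rw [← diag_iOp, h]; rfl
    exact (smul_eq_zero.1 hx').resolve_left (by simpa using hx)

end SymmetricTensors

section Laplacian

variable {V W : Type*} [NormedAddCommGroup V] [InnerProductSpace ℝ V] [FiniteDimensional ℝ V]
  [NormedAddCommGroup W] [NormedSpace ℝ W]

local notation "𝐞" => stdOrthonormalBasis ℝ V

theorem laplacian_eq_sum_fderiv_fderiv {g : V → W} (hg : ContDiff ℝ 2 g) (x : V) :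
    Δ g x = ∑ a, fderiv ℝ (fun y => fderiv ℝ g y (𝐞 a)) x (𝐞 a) := by
  have hg' : Differentiable ℝ (fderiv ℝ g) :=
    (hg.fderiv_right (m := 1) le_rfl).differentiable one_ne_zero
  simp [laplacian_eq_iteratedFDeriv_stdOrthonormalBasis, iteratedFDeriv_two_apply,
    fderiv_clm_apply (hg' x) (differentiableAt_const _)]

theorem laplacian_fun_sum {ι : Type*} (s : Finset ι) {g : ι → V → W}
    (hg : ∀ i ∈ s, ContDiff ℝ 2 (g i)) (x : V) :
    Δ (fun y => ∑ i ∈ s, g i y) x = ∑ i ∈ s, Δ (g i) x := by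
  induction s using Finset.cons_induction with
  | empty => simp
  | cons i s hi ih =>
    obtain ⟨hgi, hgs⟩ := (Finset.forall_mem_cons hi _).1 hg
    simp only [Finset.sum_cons, ← ih hgs]
    exact hgi.contDiffAt.laplacian_add (ContDiff.sum hgs).contDiffAt

theorem laplacian_fun_smul {f : V → ℝ} {g : V → W} (hf : ContDiff ℝ 2 f) (hg : ContDiff ℝ 2 g)
    (x : V) :
    Δ (fun y => f y • g y) x =
      Δ f x • g x + 2 • ∑ a, fderiv ℝ f x (𝐞 a) • fderiv ℝ g x (𝐞 a) + f x • Δ g x := by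
  have hf' : Differentiable ℝ f := hf.differentiable two_ne_zero
  have hg' : Differentiable ℝ g := hg.differentiable two_ne_zero
  have hdf (e : V) : Differentiable ℝ fun y => fderiv ℝ f y e :=
    (((hf.fderiv_right (m := 1) le_rfl).clm_apply contDiff_const).differentiable one_ne_zero)
  have hdg (e : V) : Differentiable ℝ fun y => fderiv ℝ g y e :=
    (((hg.fderiv_right (m := 1) le_rfl).clm_apply contDiff_const).differentiable one_ne_zero)
  have hfirst (e : V) : (fun y => fderiv ℝ (fun z => f z • g z) y e) =
      fun y => f y • fderiv ℝ g y e + fderiv ℝ f y e • g y :=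
    funext fun y => by simp [fderiv_fun_smul (hf' y) (hg' y)]
  have hsecond (e : V) : fderiv ℝ (fun y => fderiv ℝ (fun z => f z • g z) y e) x e =
      fderiv ℝ (fun y => fderiv ℝ f y e) x e • g x + 2 • (fderiv ℝ f x e • fderiv ℝ g x e) +
        f x • fderiv ℝ (fun y => fderiv ℝ g y e) x e := by
    rw [hfirst, fderiv_fun_add ((hf' x).fun_smul (hdg e x)) ((hdf e x).fun_smul (hg' x)),
      fderiv_fun_smul (hf' x) (hdg e x), fderiv_fun_smul (hdf e x) (hg' x)]
    simp only [add_apply, smul_apply, ContinuousLinearMap.smulRight_apply]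
    module
  have hfg : ContDiff ℝ 2 fun y => f y • g y := hf.smul hg
  simp only [laplacian_eq_sum_fderiv_fderiv hfg, laplacian_eq_sum_fderiv_fderiv hf,
    laplacian_eq_sum_fderiv_fderiv hg, hsecond, Finset.sum_add_distrib, Finset.sum_smul,
    Finset.smul_sum]

theorem laplacian_norm_sq (x : V) :
    Δ (fun y : V => ‖y‖ ^ 2) x = 2 * Module.finrank ℝ V := by
  have hfirst (e : V) : (fun y : V => fderiv ℝ (fun z : V => ‖z‖ ^ 2) y e) =
      fun y => 2 * innerSL ℝ e y :=
    funext fun y => by simp [fderiv_norm_sq_apply, real_inner_comm]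
  have hsecond (e : V) : fderiv ℝ (fun y : V => 2 * innerSL ℝ e y) x e = 2 * ‖e‖ ^ 2 := by
    rw [fderiv_const_mul (by fun_prop), ContinuousLinearMap.fderiv]
    simp
  simp only [laplacian_eq_sum_fderiv_fderiv (contDiff_norm_sq ℝ), hfirst, hsecond]
  simp [mul_comm]

theorem laplacian_clm (L : V →L[ℝ] W) (x : V) : Δ (fun y => L y) x = 0 := by
  simp [laplacian_eq_sum_fderiv_fderiv L.contDiff]

end Laplacian

section Trace

variable {𝕜 : Type*} [RCLike 𝕜] {m : ℕ} {V : Type*} [NormedAddCommGroup V]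
  [InnerProductSpace ℝ V] [FiniteDimensional ℝ V]

local notation "𝐞" => stdOrthonormalBasis ℝ V

theorem jOp_sub (F G : CovTensor 𝕜 (m + 2) V) : jOp (F - G) = jOp F - jOp G := by
  ext v
  simp [jOp, ContinuousMultilinearMap.curryLeft_apply]

theorem isSymm_jOp {T : CovTensor 𝕜 (m + 2) V} (hT : ∀ e, IsSymm (T.curryLeft e)) :
    IsSymm (jOp T) :=
  (symTensor 𝕜 m V).sum_mem fun a _ => (hT (𝐞 a)).curryLeft (𝐞 a)

theorem diag_jOp (F : CovTensor 𝕜 (m + 2) V) (x : V) :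
    diag (jOp F) x = ∑ a, diag ((F.curryLeft (𝐞 a)).curryLeft (𝐞 a)) x := by
  simp [jOp, diag]

theorem IsSymm.laplacian_diag {F : CovTensor 𝕜 (m + 2) V} (hF : IsSymm F) (x : V) :
    Δ (diag F) x = ((m + 2) * (m + 1)) • diag (jOp F) x := by
  have hfirst (e : V) : (fun y => fderiv ℝ (diag F) y e) =
      fun y => (m + 2) • diag (F.curryLeft e) y := funext fun y => hF.fderiv_diag y e
  have hsecond (e : V) : fderiv ℝ (fun y => (m + 2) • diag (F.curryLeft e) y) x e =
      ((m + 2) * (m + 1)) • diag ((F.curryLeft e).curryLeft e) x := by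
    rw [fderiv_fun_const_smul ((contDiff_diag (F.curryLeft e)).differentiable one_ne_zero x),
      smul_apply, (hF.curryLeft e).fderiv_diag, mul_smul]
  simp_rw [laplacian_eq_sum_fderiv_fderiv (contDiff_diag F), hfirst, hsecond, diag_jOp,
    Finset.smul_sum]

theorem laplacian_diag_of_mem_kerJ {F : CovTensor 𝕜 m V} (hF : F ∈ kerJ 𝕜 m V) (x : V) :
    Δ (diag F) x = 0 := by
  match m, F, hF with
  | 0, F, _ =>
    have : diag F = fun _ => F 0 := funext fun y => congrArg F (Subsingleton.elim _ _)
    simp [this]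
  | 1, F, _ =>
    exact laplacian_clm ((ContinuousMultilinearMap.ofSubsingleton ℝ V 𝕜 (0 : Fin 1)).symm F) x
  | m + 2, F, hF => rw [hF.1.laplacian_diag, show jOp F = 0 from hF.2]; simp [diag]

theorem smul_jOp_iOp {v : CovTensor 𝕜 m V} (hv : v ∈ kerJ 𝕜 m V) :
    ((m + 2) * (m + 1)) • jOp (iOp v) = (2 * (Module.finrank ℝ V + 2 * m)) • v := by
  have hsymm := isSymm_iOp v
  refine IsSymm.ext_diag ((symTensor 𝕜 m V).smul_of_tower_mem _ (isSymm_jOp hsymm.curryLeft))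
    ((symTensor 𝕜 m V).smul_of_tower_mem _ hv.1) fun x => ?_
  have hgrad : ∑ a, fderiv ℝ (fun y : V => ‖y‖ ^ 2) x (𝐞 a) • fderiv ℝ (diag v) x (𝐞 a) =
      (2 * m) • diag v x := by
    calc _ = 2 • fderiv ℝ (diag v) x (∑ a, inner ℝ (𝐞 a) x • 𝐞 a) := by
          simp [fderiv_norm_sq_apply, real_inner_comm, Finset.smul_sum, add_smul, two_smul]
      _ = (2 * m) • diag v x := by
          rw [(stdOrthonormalBasis ℝ V).sum_repr' x, fderiv_diag_self, mul_smul]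
  calc diag (((m + 2) * (m + 1)) • jOp (iOp v)) x
      = Δ (diag (iOp v)) x := (hsymm.laplacian_diag x).symm
    _ = Δ (fun y => ‖y‖ ^ 2 • diag v y) x := by rw [← funext (diag_iOp v)]
    _ = (2 * (Module.finrank ℝ V + 2 * m)) • diag v x := by
      rw [laplacian_fun_smul (contDiff_norm_sq ℝ) (contDiff_diag v), laplacian_norm_sq, hgrad,
        laplacian_diag_of_mem_kerJ hv]
      module

theorem smul_jOp_symmetrize {T : CovTensor 𝕜 (m + 2) V}
    (hT : ∀ e, T.curryLeft e ∈ kerJ 𝕜 (m + 1) V) :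
    (m + 2) • jOp (symmetrize T) = 2 • jOp T := by
  have hsymm := isSymm_symmetrize T
  refine IsSymm.ext_diag ((symTensor 𝕜 m V).smul_of_tower_mem _ (isSymm_jOp hsymm.curryLeft))
    ((symTensor 𝕜 m V).smul_of_tower_mem _ (isSymm_jOp fun e => (hT e).1)) fun x => ?_
  have hexpand (y : V) :
      diag (symmetrize T) y = ∑ a, innerSL ℝ (𝐞 a) y • diag (T.curryLeft (𝐞 a)) y := by
    have hcurry : T.curryLeft y = ∑ a, inner ℝ (𝐞 a) y • T.curryLeft (𝐞 a) := by
      conv_lhs => rw [← (stdOrthonormalBasis ℝ V).sum_repr' y]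
      simp
    rw [diag_symmetrize, ← diag_curryLeft_self, hcurry]
    simp [diag]
  have hterm (a) : Δ (fun y => innerSL ℝ (𝐞 a) y • diag (T.curryLeft (𝐞 a)) y) x =
      (2 * (m + 1)) • diag ((T.curryLeft (𝐞 a)).curryLeft (𝐞 a)) x := by
    rw [laplacian_fun_smul (innerSL ℝ (𝐞 a)).contDiff (contDiff_diag _), laplacian_clm,
      laplacian_diag_of_mem_kerJ (hT _)]
    simp only [ContinuousLinearMap.fderiv, innerSL_apply_apply]
    simp [(stdOrthonormalBasis ℝ V).inner_eq_ite, (hT _).1.fderiv_diag, mul_smul]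
  have key : ((m + 2) * (m + 1)) • diag (jOp (symmetrize T)) x =
      (2 * (m + 1)) • diag (jOp T) x := by
    rw [← hsymm.laplacian_diag, funext hexpand, laplacian_fun_sum, diag_jOp, Finset.smul_sum]
    · exact Finset.sum_congr rfl fun a _ => hterm a
    · exact fun a _ => (innerSL ℝ (𝐞 a)).contDiff.smul (contDiff_diag _)
  refine smul_right_injective 𝕜 m.succ_ne_zero ?_
  simpa [diag, mul_assoc, mul_left_comm] using key

theorem curryLeft_mem_kerJ {u : CovTensor 𝕜 (m + 1) V} (hu : u ∈ kerJ 𝕜 (m + 1) V) (e : V) :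
    u.curryLeft e ∈ kerJ 𝕜 m V := by
  refine ⟨hu.1.curryLeft e, ?_⟩
  match m, u, hu with
  | 0, _, _ => trivial
  | 1, _, _ => trivial
  | m + 2, u, hu =>
    have hcomm : jOp (u.curryLeft e) = (jOp u).curryLeft e := by
      ext v
      simp only [jOp, hu.1.curryLeft_comm e, (hu.1.curryLeft _).curryLeft_comm e]
      simp [ContinuousMultilinearMap.curryLeft_apply]
    change jOp (u.curryLeft e) = 0
    rw [hcomm, show jOp u = 0 from hu.2]
    rfl

theorem jOp_mem_kerJ {T : CovTensor 𝕜 (m + 2) V}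
    (hT : ∀ e, T.curryLeft e ∈ kerJ 𝕜 (m + 1) V) : jOp T ∈ kerJ 𝕜 m V :=
  (kerJ 𝕜 m V).sum_mem fun a _ => curryLeft_mem_kerJ (hT (𝐞 a)) (𝐞 a)

end Trace

section Projection

variable {𝕜 : Type*} [RCLike 𝕜] {m : ℕ} {V : Type*} [NormedAddCommGroup V]
  [InnerProductSpace ℝ V] [FiniteDimensional ℝ V]

local notation "𝐞" => stdOrthonormalBasis ℝ V

theorem tensorInner_apply (F G : CovTensor 𝕜 m V) :
    tensorInner F G = ∑ J : Fin m → Fin (Module.finrank ℝ V),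
      G (fun a => 𝐞 (J a)) * starRingEnd 𝕜 (F fun a => 𝐞 (J a)) := by
  simp [tensorInner, components, PiLp.inner_apply]

theorem tensorInner_self_eq_zero {F : CovTensor 𝕜 m V} : tensorInner F F = 0 ↔ F = 0 := by
  rw [tensorInner, inner_self_eq_zero, map_eq_zero_iff _ components_injective]

theorem tensorInner_eq_sum_curryLeft (F G : CovTensor 𝕜 (m + 1) V) :
    tensorInner F G = ∑ a, tensorInner (F.curryLeft (𝐞 a)) (G.curryLeft (𝐞 a)) := by
  have hcons (a) (J : Fin m → Fin (Module.finrank ℝ V)) :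
      (fun b => 𝐞 ((Fin.cons a J : Fin (m + 1) → _) b)) =
        (Fin.cons (𝐞 a) fun b => 𝐞 (J b) : Fin (m + 1) → V) :=
    funext fun b => Fin.cases rfl (fun _ => rfl) b
  simp only [tensorInner_apply, ContinuousMultilinearMap.curryLeft_apply, ← hcons]
  rw [← (Fin.consEquiv fun _ => Fin (Module.finrank ℝ V)).sum_comp, Fintype.sum_prod_type]
  rfl

theorem IsSymm.tensorInner_symmetrize {F : CovTensor 𝕜 m V} (hF : IsSymm F)
    (G : CovTensor 𝕜 m V) : tensorInner F (symmetrize G) = tensorInner F G := by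
  have hperm (s : Equiv.Perm (Fin m)) : tensorInner F (G.domDomCongr s) = tensorInner F G := by
    rw [tensorInner_apply, tensorInner_apply]
    refine Fintype.sum_equiv (Equiv.arrowCongr s.symm (Equiv.refl _)) _ _ fun J => ?_
    simp [← hF s fun a => 𝐞 (J a), Function.comp_def]
  have hcard : (m.factorial : ℝ) ≠ 0 := mod_cast m.factorial_ne_zero
  calc tensorInner F (symmetrize G)
      = (m.factorial : ℝ)⁻¹ • ∑ s : Equiv.Perm (Fin m), tensorInner F (G.domDomCongr s) := by
        simp [tensorInner, symmetrize, LinearMap.map_smul_of_tower, inner_smul_right_eq_smul,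
          inner_sum]
    _ = tensorInner F G := by
        simp only [hperm, Finset.sum_const, Finset.card_univ, Fintype.card_perm, Fintype.card_fin]
        rw [← Nat.cast_smul_eq_nsmul ℝ, inv_smul_smul₀ hcard]

theorem IsSymm.tensorInner_iOp {F : CovTensor 𝕜 (m + 2) V} (hF : IsSymm F)
    (G : CovTensor 𝕜 m V) : tensorInner F (iOp G) = tensorInner (jOp F) G := by
  have hmetric (a b) :
      ((metricMul G).curryLeft (𝐞 a)).curryLeft (𝐞 b) = if a = b then G else 0 := by
    ext v
    simp only [ContinuousMultilinearMap.curryLeft_apply, metricMul_apply]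
    split_ifs with hab <;> simp [hab]
  rw [iOp, hF.tensorInner_symmetrize, tensorInner_eq_sum_curryLeft]
  simp only [tensorInner_eq_sum_curryLeft (m := m), hmetric]
  simp [tensorInner, jOp, apply_ite, sum_inner]

theorem exists_projection (K : Submodule 𝕜 (CovTensor 𝕜 m V)) (F : CovTensor 𝕜 m V) :
    ∃ t ∈ K, ∀ k ∈ K, tensorInner k (F - t) = 0 := by
  obtain ⟨t, ht, hproj⟩ := Submodule.mem_map.1
    ((K.map components).starProjection_apply_mem (components F))
  refine ⟨t, ht, fun k hk => ?_⟩
  rw [tensorInner, map_sub, hproj]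
  exact Submodule.inner_right_of_mem_orthogonal (Submodule.mem_map_of_mem hk)
    (Submodule.sub_starProjection_mem_orthogonal _)

theorem pOp_mem (F : CovTensor 𝕜 m V) : pOp F ∈ kerJ 𝕜 m V :=
  (existsUnique_projection F).choose_spec.1.1

theorem pOp_eq {F t : CovTensor 𝕜 m V} (ht : t ∈ kerJ 𝕜 m V)
    (h : ∀ k ∈ kerJ 𝕜 m V, tensorInner k (F - t) = 0) : pOp F = t :=
  ((existsUnique_projection F).choose_spec.2 t ⟨ht, h⟩).symm

theorem pOp_of_mem {F : CovTensor 𝕜 m V} (hF : F ∈ kerJ 𝕜 m V) : pOp F = F :=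
  pOp_eq hF fun k _ => by simp [tensorInner]

theorem pOp_add_iOp {t : CovTensor 𝕜 (m + 2) V} (ht : t ∈ kerJ 𝕜 (m + 2) V)
    (v : CovTensor 𝕜 m V) : pOp (t + iOp v) = t := by
  refine pOp_eq ht fun k hk => ?_
  rw [add_sub_cancel_left, hk.1.tensorInner_iOp, show jOp k = 0 from hk.2]
  simp [tensorInner]

theorem pOp_iOp (v : CovTensor 𝕜 m V) : pOp (iOp v) = 0 := by
  rw [← zero_add (iOp v), pOp_add_iOp (zero_mem _)]

theorem IsSymm.exists_eq_pOp_add_iOp {F : CovTensor 𝕜 (m + 2) V} (hF : IsSymm F) :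
    ∃ v : CovTensor 𝕜 m V, IsSymm v ∧ F = pOp F + iOp v := by
  obtain ⟨_, ⟨v, hv, rfl⟩, hort⟩ :=
    exists_projection ((symTensor 𝕜 m V).map (isLinearMap_iOp.mk' iOp)) F
  have hsymm : IsSymm (F - iOp v) := (symTensor 𝕜 _ V).sub_mem hF (isSymm_iOp v)
  have htrace : jOp (F - iOp v) = 0 := by
    rw [← tensorInner_self_eq_zero, ← hsymm.tensorInner_iOp, tensorInner, inner_eq_zero_symm]
    exact hort _ ⟨_, isSymm_jOp hsymm.curryLeft, rfl⟩
  refine ⟨v, hv, ?_⟩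
  have hp := pOp_add_iOp (t := F - iOp v) ⟨hsymm, htrace⟩ v
  rw [sub_add_cancel] at hp
  rw [hp, sub_add_cancel]

theorem IsSymm.eq_zero_of_pOp_of_jOp {F : CovTensor 𝕜 (m + 2) V} (hF : IsSymm F)
    (hp : pOp F = 0) (hj : jOp F = 0) : F = 0 := by
  rw [← hp, pOp_of_mem ⟨hF, hj⟩]

theorem pOp_symmetrize_eq_zero_iff {T : CovTensor 𝕜 (m + 2) V}
    (hn : Module.finrank ℝ V + 2 * m ≠ 0) (hT : ∀ e, T.curryLeft e ∈ kerJ 𝕜 (m + 1) V) :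
    pOp (symmetrize T) = 0 ↔
      symmetrize T = iOp (((m + 1 : 𝕜) / (Module.finrank ℝ V + 2 * m)) • jOp T) := by
  set c : 𝕜 := (m + 1) / (Module.finrank ℝ V + 2 * m)
  refine ⟨fun hp => ?_, fun h => by rw [h, pOp_iOp]⟩
  obtain ⟨v, -, hv⟩ := (isSymm_symmetrize T).exists_eq_pOp_add_iOp
  rw [hp, zero_add] at hv
  have hsub : symmetrize T - iOp (c • jOp T) = iOp (v - c • jOp T) := by
    rw [iOp_sub, ← hv]
  have htrace : ((m + 2) * (m + 1)) • jOp (symmetrize T) =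
      ((m + 2) * (m + 1)) • jOp (iOp (c • jOp T)) := by
    have hcn : c * (Module.finrank ℝ V + 2 * m) = m + 1 := div_mul_cancel₀ _ (mod_cast hn)
    rw [smul_jOp_iOp ((kerJ 𝕜 m V).smul_mem c (jOp_mem_kerJ hT)), mul_comm, mul_smul,
      smul_jOp_symmetrize hT]
    ext w
    simp only [smul_apply, nsmul_eq_mul, Nat.cast_ofNat, Nat.cast_add, Nat.cast_one,
      smul_eq_mul, Nat.cast_mul]
    linear_combination (-2 * jOp T w) * hcn
  refine sub_eq_zero.1 (IsSymm.eq_zero_of_pOp_of_jOp ?_ ?_ ?_)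
  · exact (symTensor 𝕜 _ V).sub_mem (isSymm_symmetrize T) (isSymm_iOp _)
  · rw [hsub, pOp_iOp]
  · rw [jOp_sub, sub_eq_zero]
    have hm : (m + 2) * (m + 1) ≠ 0 := by positivity
    refine smul_right_injective _ (Nat.cast_ne_zero (R := 𝕜).2 hm) ?_
    simpa only [Nat.cast_smul_eq_nsmul] using htrace

end Projection

section Separating

variable {𝕜 : Type*} [RCLike 𝕜] {ι X : Type*} [NormedAddCommGroup X] [NormedSpace 𝕜 X]
  [FiniteDimensional 𝕜 X] {ℓ : ι → X →ₗ[𝕜] 𝕜}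

theorem exists_eq_sum_smul_of_separating (hℓ : ∀ x, (∀ i, ℓ i x = 0) → x = 0) :
    ∃ (s : Finset ι) (a : ι → X), ∀ x, x = ∑ i ∈ s, ℓ i x • a i := by
  have hspan : Submodule.span 𝕜 (Set.range ℓ) = ⊤ :=
    Submodule.span_eq_top_of_ne_zero fun x hx => by simpa using mt (hℓ x) hx
  let b := Module.finBasis 𝕜 X
  have hcoord (j) : ∃ c : ι →₀ 𝕜, c.sum (fun i r => r • ℓ i) = b.coord j :=
    Finsupp.mem_span_range_iff_exists_finsupp.1 (hspan ▸ Submodule.mem_top)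
  choose c hc using hcoord
  classical
  refine ⟨Finset.univ.biUnion fun j => (c j).support, fun i => ∑ j, c j i • b j, fun x => ?_⟩
  have hx (j) : b.coord j x = ∑ i ∈ Finset.univ.biUnion fun j => (c j).support, c j i * ℓ i x := by
    rw [← hc j, Finsupp.sum_of_support_subset (c j)
      (Finset.subset_biUnion_of_mem (fun j => (c j).support) (Finset.mem_univ j)) _ (by simp)]
    simp
  conv_lhs => rw [← b.sum_repr x]
  simp only [← b.coord_apply, hx, Finset.sum_smul, Finset.smul_sum, smul_smul]
  rw [Finset.sum_comm]
  simp only [mul_comm]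

variable [NormedSpace ℝ X] [IsScalarTower ℝ 𝕜 X]

theorem contDiffOn_of_separating {E : Type*} [NormedAddCommGroup E] [NormedSpace ℝ E]
    {k : WithTop ℕ∞} {φ : E → X} {s : Set E} (hℓ : ∀ x, (∀ i, ℓ i x = 0) → x = 0)
    (hφ : ∀ i, ContDiffOn ℝ k (fun u => ℓ i (φ u)) s) : ContDiffOn ℝ k φ s := by
  obtain ⟨t, a, ha⟩ := exists_eq_sum_smul_of_separating hℓ
  rw [funext fun u => ha (φ u)]
  exact ContDiffOn.sum fun i _ => (hφ i).smul contDiffOn_const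

theorem hasDerivAt_of_separating {φ : ℝ → X} {φ' : X} {t : ℝ}
    (hℓ : ∀ x, (∀ i, ℓ i x = 0) → x = 0)
    (hφ : ∀ i, HasDerivAt (fun t => ℓ i (φ t)) (ℓ i φ') t) : HasDerivAt φ φ' t := by
  obtain ⟨s, a, ha⟩ := exists_eq_sum_smul_of_separating hℓ
  rw [funext fun t => ha (φ t), ha φ']
  exact HasDerivAt.fun_sum fun i _ => (hφ i).smul_const _

end Separating

section TensorFamilies

variable {𝕜 : Type*} [RCLike 𝕜] {m : ℕ} {V : Type*} [NormedAddCommGroup V]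
  [InnerProductSpace ℝ V]

variable (𝕜) in
/-- Evaluation of tensors at a given list of vectors, as a linear functional. -/
def evalTensor (v : Fin m → V) : CovTensor 𝕜 m V →ₗ[𝕜] 𝕜 where
  toFun F := F v
  map_add' _ _ := rfl
  map_smul' _ _ := rfl

theorem IsSymm.eq_zero_of_forall_ne_zero [Nontrivial V] {F : CovTensor 𝕜 m V} (hF : IsSymm F)
    (h : ∀ x ≠ 0, diag F x = 0) : F = 0 := by
  refine hF.eq_zero_of_diag_eq_zero (funext fun x => ?_)
  have hclosed : IsClosed {x | diag F x = 0} :=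
    isClosed_eq (contDiff_diag F (k := 0)).continuous continuous_const
  exact (hclosed.closure_subset_iff.2 h) (dense_compl_singleton (0 : V) x)

variable [FiniteDimensional ℝ V]

instance : FiniteDimensional 𝕜 (CovTensor 𝕜 m V) :=
  FiniteDimensional.of_injective components components_injective

theorem hasDerivAt_covTensor {φ : ℝ → CovTensor 𝕜 m V} {φ' : CovTensor 𝕜 m V} {t : ℝ}
    (hφ : ∀ v, HasDerivAt (fun t => φ t v) (φ' v) t) : HasDerivAt φ φ' t :=
  hasDerivAt_of_separating (ℓ := evalTensor 𝕜) (fun _ h => ContinuousMultilinearMap.ext h) hφ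

theorem contDiffOn_of_diag [Nontrivial V] {E : Type*} [NormedAddCommGroup E] [NormedSpace ℝ E]
    {k : WithTop ℕ∞} {φ : E → CovTensor 𝕜 m V} {s : Set E} (hsymm : ∀ u, IsSymm (φ u))
    (hφ : ∀ x ≠ 0, ContDiffOn ℝ k (fun u => diag (φ u) x) s) : ContDiffOn ℝ k φ s := by
  have hφ' : ContDiffOn ℝ k (fun u => (⟨φ u, hsymm u⟩ : symTensor 𝕜 m V)) s :=
    contDiffOn_of_separating
      (ℓ := fun x : {x : V // x ≠ 0} => (evalTensor 𝕜 fun _ => x.1).comp (symTensor 𝕜 m V).subtype)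
      (fun F hF => Subtype.ext <| IsSymm.eq_zero_of_forall_ne_zero F.2 fun x hx => hF ⟨x, hx⟩)
      fun x => hφ x x.2
  exact ((symTensor 𝕜 m V).subtypeL.restrictScalars ℝ).contDiff.comp_contDiffOn hφ'

end TensorFamilies

section Frames

variable {𝕜 : Type*} [RCLike 𝕜] {m : ℕ} {V W : Type*} [NormedAddCommGroup V]
  [InnerProductSpace ℝ V] [NormedAddCommGroup W] [InnerProductSpace ℝ W]

/-- The tensor `(v₀, v₁, …, vₘ) ↦ F(R v₀, v₁, …, vₘ)`; when `R` is the inverse of the Gram operator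
of a frame, this raises the first index of `F`. -/
def compFirst (R : W →L[ℝ] W) (F : CovTensor 𝕜 (m + 1) W) : CovTensor 𝕜 (m + 1) W :=
  (F.curryLeft.comp R).uncurryLeft

theorem curryLeft_compFirst (R : W →L[ℝ] W) (F : CovTensor 𝕜 (m + 1) W) (w : W) :
    (compFirst R F).curryLeft w = F.curryLeft (R w) := rfl

variable [FiniteDimensional ℝ V] [FiniteDimensional ℝ W]

local notation "𝐞" => stdOrthonormalBasis ℝ

/-- The operator `P* P` on `W` whose matrix is the Gram matrix of the frame `P` of `V`. -/
def gramOperator (P : W →ₗ[ℝ] V) : W →L[ℝ] W := (P.adjoint ∘ₗ P).toContinuousLinearMap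

theorem inner_gramOperator (P : W →ₗ[ℝ] V) (x y : W) : ⟪gramOperator P x, y⟫_ℝ = ⟪P x, P y⟫_ℝ :=
  P.adjoint_inner_left y (P x)

theorem isUnit_gramOperator_iff {P : W →ₗ[ℝ] V} :
    IsUnit (gramOperator P) ↔ Function.Injective P := by
  rw [ContinuousLinearMap.isUnit_iff_isUnit_toLinearMap, LinearMap.isUnit_iff_ker_eq_bot,
    ← LinearMap.ker_eq_bot, LinearMap.ker_eq_bot', LinearMap.ker_eq_bot']
  refine forall_congr' fun x => imp_congr_left ⟨fun h => ?_, fun h => ?_⟩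
  · rw [← inner_self_eq_zero (𝕜 := ℝ), ← inner_gramOperator]
    exact h ▸ inner_zero_left _
  · exact (congrArg P.adjoint h).trans (map_zero _)

theorem sum_curryLeft_eq_jOp {κ : Type*} [Fintype κ] {p q : κ → V}
    (hpq : ∀ y, ∑ k, ⟪y, q k⟫_ℝ • p k = y) (F : CovTensor 𝕜 (m + 2) V) :
    ∑ k, (F.curryLeft (p k)).curryLeft (q k) = jOp F := by
  calc ∑ k, (F.curryLeft (p k)).curryLeft (q k)
      = ∑ k, ∑ a, (F.curryLeft (⟪𝐞 V a, q k⟫_ℝ • p k)).curryLeft (𝐞 V a) := by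
        refine Finset.sum_congr rfl fun k _ => ?_
        conv_lhs => rw [← (𝐞 V).sum_repr' (q k), map_sum]
        refine Finset.sum_congr rfl fun a _ => ?_
        rw [map_smul, map_smul]
        rfl
    _ = ∑ a, (F.curryLeft (∑ k, ⟪𝐞 V a, q k⟫_ℝ • p k)).curryLeft (𝐞 V a) := by
        rw [Finset.sum_comm]
        refine Finset.sum_congr rfl fun a _ => ?_
        rw [map_sum]
        ext v
        simp
    _ = jOp F := by
        simp only [hpq]
        rfl

theorem sum_inner_smul_inverse_gramOperator {P : W →ₗ[ℝ] V} (hP : Function.Bijective P) (y : V) :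
    ∑ k, ⟪y, P (𝐞 W k)⟫_ℝ • P (Ring.inverse (gramOperator P) (𝐞 W k)) = y := by
  obtain ⟨x, rfl⟩ := hP.surjective y
  have hcancel : Ring.inverse (gramOperator P) (gramOperator P x) = x :=
    DFunLike.congr_fun (Ring.inverse_mul_cancel _ (isUnit_gramOperator_iff.2 hP.injective)) x
  have hsum := (𝐞 W).sum_repr' (gramOperator P x)
  simp only [real_inner_comm (gramOperator P x), inner_gramOperator] at hsum
  rw [← congrArg P hcancel]
  conv_rhs => rw [← hsum]
  simp only [map_sum, map_smul, hcancel]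

theorem jOp_compFirst_inverse_gramOperator {P : W →L[ℝ] V} (hP : Function.Bijective P)
    (F : CovTensor 𝕜 (m + 2) V) :
    jOp (compFirst (Ring.inverse (gramOperator P.toLinearMap))
        (F.compContinuousLinearMap fun _ => P)) =
      (jOp F).compContinuousLinearMap fun _ => P := by
  rw [← sum_curryLeft_eq_jOp (sum_inner_smul_inverse_gramOperator (P := P.toLinearMap) hP) F]
  ext v
  simp only [jOp, sum_apply, curryLeft_compFirst, ContinuousMultilinearMap.curryLeft_apply,
    ContinuousMultilinearMap.compContinuousLinearMap_apply]
  refine Finset.sum_congr rfl fun k _ => congrArg F (funext fun a => ?_)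
  exact Fin.cases rfl (Fin.cases rfl fun _ => rfl) a

theorem hasDerivAt_ringInverse_zero {R : Type*} [NormedRing R] [NormedAlgebra ℝ R]
    [HasSummableGeomSeries R] {H : ℝ → R} {t : ℝ} (h : HasDerivAt H 0 t) (hu : IsUnit (H t)) :
    HasDerivAt (fun t => Ring.inverse (H t)) 0 t := by
  obtain ⟨a, ha⟩ := hu
  have hinv := hasFDerivAt_ringInverse (𝕜 := ℝ) a
  rw [ha] at hinv
  convert! hinv.comp_hasDerivAt t h using 1
  exact (map_zero _).symm

theorem hasDerivAt_jOp_compFirst {R : ℝ → W →L[ℝ] W} {F : ℝ → CovTensor 𝕜 (m + 2) W}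
    {F' : CovTensor 𝕜 (m + 2) W} {t : ℝ} (hR : HasDerivAt R 0 t) (hF : HasDerivAt F F' t) :
    HasDerivAt (fun t => jOp (compFirst (R t) (F t))) (jOp (compFirst (R t) F')) t := by
  refine HasDerivAt.fun_sum fun a _ => hasDerivAt_covTensor fun v => ?_
  have harg (b) : HasDerivAt
      (fun t => (Fin.cons (R t (𝐞 W a)) (Fin.cons (𝐞 W a) v) : Fin (m + 2) → W) b) 0 t := by
    refine Fin.cases ?_ (fun b => hasDerivAt_const t _) b
    simpa using hR.clm_apply (hasDerivAt_const t (𝐞 W a))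
  have h := (hF.hasFDerivAt.continuousMultilinearMap_apply fun b => (harg b).hasFDerivAt).hasDerivAt
  convert! h using 1
  simp only [ContinuousMultilinearMap.curryLeft_apply, ContinuousLinearMap.toSpanSingleton_zero,
    ContinuousLinearMap.comp_zero, Finset.sum_const_zero, add_zero, ContinuousLinearMap.comp_apply,
    ContinuousLinearMap.toSpanSingleton_apply, one_smul, ContinuousMultilinearMap.apply_apply]
  rfl

end Frames

section CoordinateFrames

variable {n : ℕ} {M : Type*} [TopologicalSpace M] [ChartedSpace (EuclideanSpace ℝ (Fin n)) M]

theorem coordFrame_eq_mfderivWithin (c : M) (u : EuclideanSpace ℝ (Fin n)) :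
    coordFrame c u =
      mfderivWithin (𝓡 n) (𝓡 n) (extChartAt (𝓡 n) c).symm (Set.range (𝓡 n)) u := by
  rw [ModelWithCorners.range_eq_univ, mfderivWithin_univ]
  rfl

/-- The coordinate frame of the chart around `x` at the point `x` itself. It agrees with
`coordFrame` by definition; only the base point `(extChartAt (𝓡 n) x).symm (extChartAt (𝓡 n) x x)`
of the target is replaced by `x`. -/
def centerFrame (x : M) : EuclideanSpace ℝ (Fin n) →L[ℝ] TangentSpace (𝓡 n) x :=
  coordFrame x (extChartAt (𝓡 n) x x)

variable [IsManifold (𝓡 n) ∞ M]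

theorem coordFrame_bijective {c : M} {u : EuclideanSpace ℝ (Fin n)}
    (hu : u ∈ (extChartAt (𝓡 n) c).target) : Function.Bijective (coordFrame c u) := by
  have : IsManifold (𝓡 n) 1 M := IsManifold.of_le (n := ∞) (by simp)
  rw [coordFrame_eq_mfderivWithin]
  exact (isInvertible_mfderivWithin_extChartAt_symm hu).bijective

theorem chartDifferential_centerFrame (x : M) (a : EuclideanSpace ℝ (Fin n)) :
    chartDifferential x (centerFrame x a) = a := by
  have : IsManifold (𝓡 n) 1 M := IsManifold.of_le (n := ∞) (by simp)
  rw [centerFrame, coordFrame_eq_mfderivWithin]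
  exact DFunLike.congr_fun (mfderiv_extChartAt_comp_mfderivWithin_extChartAt_symm' (I := 𝓡 n)
    (mem_extChartAt_source (I := 𝓡 n) x)) a

theorem centerFrame_bijective (x : M) : Function.Bijective (centerFrame (n := n) x) :=
  coordFrame_bijective (mem_extChartAt_target x)

theorem centerFrame_chartDifferential (x : M) (X : TangentSpace (𝓡 n) x) :
    centerFrame x (chartDifferential x X) = X := by
  obtain ⟨a, rfl⟩ := (centerFrame_bijective x).surjective X
  rw [chartDifferential_centerFrame]

theorem contMDiffOn_coordFrame (c : M) (a : EuclideanSpace ℝ (Fin n)) :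
    ContMDiffOn (𝓡 n) ((𝓡 n).prod (𝓡 n)) ∞
      (fun u => (⟨(extChartAt (𝓡 n) c).symm u, coordFrame c u a⟩ : TangentBundle (𝓡 n) M))
      (extChartAt (𝓡 n) c).target := by
  have : IsManifold (𝓡 n) 1 M := IsManifold.of_le (n := ∞) (by simp)
  have hmap := (contMDiffOn_extChartAt_symm (I := 𝓡 n) (n := ∞) c).contMDiffOn_tangentMapWithin
    (m := ∞) (by simp) (isOpen_extChartAt_target c).uniqueMDiffOn
  have hconst := (contMDiff_vectorSpace_iff_contDiff (𝕜 := ℝ) (n := ∞)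
    (V := fun _ : EuclideanSpace ℝ (Fin n) => a)).2 contDiff_const
  refine (hmap.comp hconst.contMDiffOn (fun u hu => hu)).congr fun u hu => ?_
  simp only [Function.comp, tangentMapWithin]
  rw [mfderivWithin_of_isOpen (isOpen_extChartAt_target c) hu]
  rfl

end CoordinateFrames

section MetricInCharts

theorem hasDerivAt_comp_line {E F : Type*} [NormedAddCommGroup E] [NormedSpace ℝ E]
    [NormedAddCommGroup F] [NormedSpace ℝ F] {φ : E → F} {u : E} (hφ : DifferentiableAt ℝ φ u)
    (w : E) : HasDerivAt (fun t : ℝ => φ (u + t • w)) (fderiv ℝ φ u w) 0 :=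
  hφ.hasFDerivAt.hasLineDerivAt w

theorem eq_zero_of_apply_single {n : ℕ} {f : EuclideanSpace ℝ (Fin n) → ℝ} (hf : IsLinearMap ℝ f)
    (h : ∀ i, f (EuclideanSpace.single i 1) = 0) (a : EuclideanSpace ℝ (Fin n)) : f a = 0 := by
  have hzero : hf.mk' f = 0 := (EuclideanSpace.basisFun (Fin n) ℝ).toBasis.ext fun i => by
    simpa using h i
  exact LinearMap.congr_fun hzero a

variable {n : ℕ} {M : Type*} [TopologicalSpace M] [ChartedSpace (EuclideanSpace ℝ (Fin n)) M]
  [RiemannianBundle (fun x : M => TangentSpace (𝓡 n) x)]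

/-- The metric tensor read in the chart around `c`, as a bilinear form on `ℝⁿ`; its matrix is
`metricCoeff`. -/
def chartForm (c : M) (u : EuclideanSpace ℝ (Fin n)) :
    EuclideanSpace ℝ (Fin n) →L[ℝ] EuclideanSpace ℝ (Fin n) →L[ℝ] ℝ :=
  (innerSL ℝ).bilinearComp (coordFrame c u) (coordFrame c u)

theorem chartForm_apply (c : M) (u a b : EuclideanSpace ℝ (Fin n)) :
    chartForm c u a b = inner ℝ (coordFrame c u a) (coordFrame c u b) := rfl

theorem chartForm_comm (c : M) (u a b : EuclideanSpace ℝ (Fin n)) :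
    chartForm c u a b = chartForm c u b a := by
  rw [chartForm_apply, chartForm_apply, real_inner_comm]

theorem metricCoeff_eq (c : M) (u : EuclideanSpace ℝ (Fin n)) (i j : Fin n) :
    metricCoeff c u i j =
      chartForm c u (EuclideanSpace.single i 1) (EuclideanSpace.single j 1) := rfl

theorem inner_centerFrame (x : M) (a b : EuclideanSpace ℝ (Fin n)) :
    inner ℝ (centerFrame x a) (centerFrame x b) = chartForm x (extChartAt (𝓡 n) x x) a b := by
  have key (y : M) (hy : y = x) (a b : EuclideanSpace ℝ (Fin n)) :
      @inner ℝ (TangentSpace (𝓡 n) x) _ a b = @inner ℝ (TangentSpace (𝓡 n) y) _ a b := by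
    subst hy
    rfl
  exact key _ (extChartAt_to_inv (I := 𝓡 n) x) _ _

theorem metricDeriv_comm (c : M) (u : EuclideanSpace ℝ (Fin n)) (k i j : Fin n) :
    metricDeriv c u k i j = metricDeriv c u k j i := by
  simp only [metricDeriv, metricCoeff_eq, chartForm_comm c _ (EuclideanSpace.single i 1)]

theorem christoffelMap_apply (c : M) (u w a : EuclideanSpace ℝ (Fin n)) (k : Fin n) :
    christoffelMap c u w a k = ∑ i, ∑ j, christoffel c u k i j * (w i * a j) := by
  simp [christoffelMap, Finset.sum_apply, Pi.single_apply]

theorem christoffelMap_single (c : M) (u : EuclideanSpace ℝ (Fin n)) (i j : Fin n) :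
    christoffelMap c u (EuclideanSpace.single i 1) (EuclideanSpace.single j 1) =
      ∑ k, christoffel c u k i j • EuclideanSpace.single k (1 : ℝ) := by
  ext l
  simp [christoffelMap_apply, Finset.sum_apply, Pi.single_apply]

variable [IsManifold (𝓡 n) ∞ M]

theorem isUnit_metricCoeff {c : M} {u : EuclideanSpace ℝ (Fin n)}
    (hu : u ∈ (extChartAt (𝓡 n) c).target) : IsUnit (metricCoeff c u) := by
  have hframe : LinearIndependent ℝ fun i => coordFrame c u (EuclideanSpace.single i 1) := by
    have hbasis := (EuclideanSpace.basisFun (Fin n) ℝ).toBasis.linearIndependent.map'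
      (coordFrame c u).toLinearMap (LinearMap.ker_eq_bot.2 (coordFrame_bijective hu).injective)
    convert! hbasis using 2 with i
    exact congrArg _ (by simp)
  exact (Matrix.posDef_gram_of_linearIndependent hframe).isUnit

theorem chartForm_christoffelMap_single {c : M} {u : EuclideanSpace ℝ (Fin n)}
    (hu : u ∈ (extChartAt (𝓡 n) c).target) (i j p : Fin n) :
    chartForm c u (christoffelMap c u (EuclideanSpace.single i 1) (EuclideanSpace.single j 1))
        (EuclideanSpace.single p 1) =
      (1 / 2) * (metricDeriv c u i j p + metricDeriv c u j i p - metricDeriv c u p i j) := by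
  have hinv : (metricCoeff c u)⁻¹.transpose * metricCoeff c u = 1 := by
    have hsymm : (metricCoeff c u).transpose = metricCoeff c u :=
      Matrix.ext fun _ _ => chartForm_comm c u _ _
    rw [Matrix.transpose_nonsing_inv, hsymm]
    exact Matrix.nonsing_inv_mul _ ((Matrix.isUnit_iff_isUnit_det _).1 (isUnit_metricCoeff hu))
  have hinv_apply (l : Fin n) :
      ∑ k, (metricCoeff c u)⁻¹ k l * metricCoeff c u k p = (1 : Matrix (Fin n) (Fin n) ℝ) l p := by
    rw [← hinv, Matrix.mul_apply]
    rfl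
  set X : Fin n → ℝ := fun l =>
    metricDeriv c u i j l + metricDeriv c u j i l - metricDeriv c u l i j
  calc _ = ∑ k, christoffel c u k i j * metricCoeff c u k p := by
        simp [christoffelMap_single, metricCoeff_eq]
    _ = (1 / 2) * ∑ k, ∑ l, (metricCoeff c u)⁻¹ k l * metricCoeff c u k p * X l := by
        simp only [christoffel, Finset.mul_sum, Finset.sum_mul]
        exact Finset.sum_congr rfl fun k _ => Finset.sum_congr rfl fun l _ => by ring
    _ = (1 / 2) * X p := by
        rw [Finset.sum_comm]
        simp only [← Finset.sum_mul, hinv_apply, Matrix.one_apply, ite_mul, one_mul, zero_mul,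
          Finset.sum_ite_eq', Finset.mem_univ, if_true]

variable [IsContMDiffRiemannianBundle (𝓡 n) ∞ (EuclideanSpace ℝ (Fin n))
      (fun x : M => TangentSpace (𝓡 n) x)]

theorem contDiffOn_chartForm_apply (c : M) (a b : EuclideanSpace ℝ (Fin n)) :
    ContDiffOn ℝ ∞ (fun u => chartForm c u a b) (extChartAt (𝓡 n) c).target := by
  rw [← contMDiffOn_iff_contDiffOn]
  exact (contMDiffOn_coordFrame c a).inner_bundle (contMDiffOn_coordFrame c b)

theorem differentiableAt_chartForm {c : M} {u : EuclideanSpace ℝ (Fin n)}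
    (hu : u ∈ (extChartAt (𝓡 n) c).target) : DifferentiableAt ℝ (chartForm c) u := by
  have hsmooth : ContDiffOn ℝ ∞ (chartForm c) (extChartAt (𝓡 n) c).target :=
    contDiffOn_clm_apply.2 fun a => contDiffOn_clm_apply.2 fun b => contDiffOn_chartForm_apply c a b
  exact (hsmooth.contDiffAt ((isOpen_extChartAt_target c).mem_nhds hu)).differentiableAt (by simp)

theorem fderiv_chartForm_single {c : M} {u : EuclideanSpace ℝ (Fin n)}
    (hu : u ∈ (extChartAt (𝓡 n) c).target) (k i j : Fin n) :
    fderiv ℝ (chartForm c) u (EuclideanSpace.single k 1) (EuclideanSpace.single i 1)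
      (EuclideanSpace.single j 1) = metricDeriv c u k i j := by
  have h := differentiableAt_chartForm hu
  simp only [metricDeriv, metricCoeff_eq]
  rw [fderiv_clm_apply (h.clm_apply (differentiableAt_const _)) (differentiableAt_const _),
    fderiv_clm_apply h (differentiableAt_const _)]
  simp

set_option synthInstance.maxHeartbeats 200000 in
-- The norm on bilinear and trilinear forms is found by a long instance search.
theorem fderiv_chartForm {c : M} {u : EuclideanSpace ℝ (Fin n)}
    (hu : u ∈ (extChartAt (𝓡 n) c).target) (w a b : EuclideanSpace ℝ (Fin n)) :
    fderiv ℝ (chartForm c) u w a b =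
      chartForm c u (christoffelMap c u w a) b + chartForm c u a (christoffelMap c u w b) := by
  rw [← sub_eq_zero]
  refine eq_zero_of_apply_single (f := fun w => fderiv ℝ (chartForm c) u w a b -
    (chartForm c u (christoffelMap c u w a) b + chartForm c u a (christoffelMap c u w b)))
    ⟨fun _ _ => ?_, fun _ _ => ?_⟩ (fun k => ?_) w
  · simp only [map_add, add_apply]; ring
  · simp only [map_smul, smul_apply, smul_eq_mul]; ring
  refine eq_zero_of_apply_single (f := fun a => fderiv ℝ (chartForm c) u _ a b -
    (chartForm c u (christoffelMap c u _ a) b + chartForm c u a (christoffelMap c u _ b)))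
    ⟨fun _ _ => ?_, fun _ _ => ?_⟩ (fun i => ?_) a
  · simp only [map_add, add_apply]; ring
  · simp only [map_smul, smul_apply, smul_eq_mul]; ring
  refine eq_zero_of_apply_single (f := fun b => fderiv ℝ (chartForm c) u _ _ b -
    (chartForm c u (christoffelMap c u _ _) b + chartForm c u _ (christoffelMap c u _ b)))
    ⟨fun _ _ => ?_, fun _ _ => ?_⟩ (fun j => ?_) b
  · simp only [map_add]; ring
  · simp only [map_smul, smul_eq_mul]; ring
  rw [fderiv_chartForm_single hu, chartForm_comm c u (EuclideanSpace.single i 1),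
    chartForm_christoffelMap_single hu, chartForm_christoffelMap_single hu,
    metricDeriv_comm c u i k j, metricDeriv_comm c u k j i]
  ring

/-- Parallel transport along the straight line `t ↦ u + t • w` in the chart around `c`, up to the
first order in `t`. -/
def lineTransport (c : M) (u w : EuclideanSpace ℝ (Fin n)) (t : ℝ) :
    EuclideanSpace ℝ (Fin n) →L[ℝ] EuclideanSpace ℝ (Fin n) :=
  ContinuousLinearMap.id ℝ _ - t • christoffelMap c u w

set_option synthInstance.maxHeartbeats 200000 in
-- The norm on bilinear and trilinear forms is found by a long instance search.
theorem hasDerivAt_chartForm_lineTransport {c : M} {u : EuclideanSpace ℝ (Fin n)}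
    (hu : u ∈ (extChartAt (𝓡 n) c).target) (w a b : EuclideanSpace ℝ (Fin n)) :
    HasDerivAt (fun t : ℝ => chartForm c (u + t • w) (lineTransport c u w t a)
      (lineTransport c u w t b)) 0 0 := by
  have hform : HasDerivAt (fun t : ℝ => chartForm c (u + t • w))
      (fderiv ℝ (chartForm c) u w) 0 :=
    hasDerivAt_comp_line (F := EuclideanSpace ℝ (Fin n) →L[ℝ] EuclideanSpace ℝ (Fin n) →L[ℝ] ℝ)
      (φ := chartForm c) (differentiableAt_chartForm hu) w
  have htransport (a : EuclideanSpace ℝ (Fin n)) : HasDerivAt (fun t => lineTransport c u w t a)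
      (-christoffelMap c u w a) 0 := by
    simpa [lineTransport] using
      ((hasDerivAt_id (0 : ℝ)).smul_const (christoffelMap c u w a)).const_sub a
  have h := (hform.clm_apply (htransport a)).clm_apply (htransport b)
  convert! h using 1
  simp [fderiv_chartForm hu, lineTransport]

end MetricInCharts

section SmoothFields

variable {𝕜 : Type*} [RCLike 𝕜] {m n : ℕ} {M : Type*} [TopologicalSpace M]
  [ChartedSpace (EuclideanSpace ℝ (Fin n)) M]
  [RiemannianBundle (fun x : M => TangentSpace (𝓡 n) x)]

theorem inChart_add (f h : TensorField n M 𝕜 m) (c : M) :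
    inChart (f + h) c = inChart f c + inChart h c := rfl

theorem inChart_smul (k : 𝕜) (f : TensorField n M 𝕜 m) (c : M) :
    inChart (k • f) c = k • inChart f c := rfl

theorem diag_inChart (f : TensorField n M 𝕜 m) (c : M) (u z : EuclideanSpace ℝ (Fin n)) :
    diag (inChart f c u) z = diag (f ((extChartAt (𝓡 n) c).symm u)) (coordFrame c u z) := rfl

theorem isSymm_inChart {f : TensorField n M 𝕜 m} (hf : ∀ x, IsSymm (f x)) (c : M)
    (u : EuclideanSpace ℝ (Fin n)) : IsSymm (inChart f c u) :=
  fun s v => hf _ s fun a => coordFrame c u (v a)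

theorem IsSmoothSymm.add {f h : TensorField n M 𝕜 m} (hf : IsSmoothSymm f) (hh : IsSmoothSymm h) :
    IsSmoothSymm (f + h) :=
  ⟨fun x => (symTensor 𝕜 m _).add_mem (hf.symm x) (hh.symm x),
    fun c => (hf.smooth c).add (hh.smooth c)⟩

theorem IsSmoothSymm.smul {f : TensorField n M 𝕜 m} (hf : IsSmoothSymm f) (k : 𝕜) :
    IsSmoothSymm (k • f) :=
  ⟨fun x => (symTensor 𝕜 m _).smul_mem k (hf.symm x), fun c => (hf.smooth c).const_smul k⟩

theorem IsSmoothSymm.sub {f h : TensorField n M 𝕜 m} (hf : IsSmoothSymm f) (hh : IsSmoothSymm h) :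
    IsSmoothSymm (f - h) :=
  ⟨fun x => (symTensor 𝕜 m _).sub_mem (hf.symm x) (hh.symm x),
    fun c => (hf.smooth c).sub (hh.smooth c)⟩

theorem IsSmoothSymm.contDiffOn_diag {f : TensorField n M 𝕜 m} (hf : IsSmoothSymm f) (c : M)
    (z : EuclideanSpace ℝ (Fin n)) :
    ContDiffOn ℝ ∞ (fun u => diag (inChart f c u) z) (extChartAt (𝓡 n) c).target :=
  (ContinuousMultilinearMap.apply ℝ (fun _ : Fin m => EuclideanSpace ℝ (Fin n)) 𝕜
    fun _ => z).contDiff.comp_contDiffOn (hf.smooth c)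

theorem isSmoothSymm_of_diag {f : TensorField n M 𝕜 m} (hf : ∀ x, IsSymm (f x))
    (hsmooth : ∀ c : M, ∀ z ≠ 0,
      ContDiffOn ℝ ∞ (fun u => diag (inChart f c u) z) (extChartAt (𝓡 n) c).target) :
    IsSmoothSymm f := by
  refine ⟨hf, fun c => ?_⟩
  rcases subsingleton_or_nontrivial (EuclideanSpace ℝ (Fin n)) with h | h
  · exact (contDiffOn_const (c := inChart f c 0)).congr fun u _ =>
      congrArg _ (Subsingleton.elim u 0)
  · exact contDiffOn_of_diag (isSymm_inChart hf c) (hsmooth c)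

theorem IsSmoothSymm.differentiableAt {f : TensorField n M 𝕜 m} (hf : IsSmoothSymm f) {c : M}
    {u : EuclideanSpace ℝ (Fin n)} (hu : u ∈ (extChartAt (𝓡 n) c).target) :
    DifferentiableAt ℝ (inChart f c) u :=
  ((hf.smooth c).contDiffAt ((isOpen_extChartAt_target c).mem_nhds hu)).differentiableAt (by simp)

end SmoothFields

section CovariantDerivative

variable {𝕜 : Type*} [RCLike 𝕜] {m n : ℕ} {M : Type*} [TopologicalSpace M]
  [ChartedSpace (EuclideanSpace ℝ (Fin n)) M]
  [RiemannianBundle (fun x : M => TangentSpace (𝓡 n) x)]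

theorem hasDerivAt_inChart_lineTransport_apply {f : TensorField n M 𝕜 m} {c : M}
    {u : EuclideanSpace ℝ (Fin n)} (hf : DifferentiableAt ℝ (inChart f c) u)
    (w : EuclideanSpace ℝ (Fin n)) (v : Fin m → EuclideanSpace ℝ (Fin n)) :
    HasDerivAt (fun t : ℝ => inChart f c (u + t • w) fun a => lineTransport c u w t (v a))
      (nablaInChart f c u w v) 0 := by
  have htransport (a : Fin m) : HasDerivAt (fun t => lineTransport c u w t (v a))
      (-christoffelMap c u w (v a)) 0 := by
    simpa [lineTransport] using
      ((hasDerivAt_id (0 : ℝ)).smul_const (christoffelMap c u w (v a))).const_sub (v a)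
  have h := ((hasDerivAt_comp_line hf w).hasFDerivAt.continuousMultilinearMap_apply
    fun a => (htransport a).hasFDerivAt).hasDerivAt
  have hneg (s : Fin m) :
      inChart f c u (Function.update v s (-christoffelMap c u w (v s))) =
        -inChart f c u (Function.update v s (christoffelMap c u w (v s))) :=
    (inChart f c u).toMultilinearMap.map_update_neg _ _ _
  convert! h using 1
  simp [nablaInChart_apply, lineTransport, sub_eq_add_neg, hneg]

theorem hasDerivAt_inChart_lineTransport {f : TensorField n M 𝕜 m} {c : M}
    {u : EuclideanSpace ℝ (Fin n)} (hf : DifferentiableAt ℝ (inChart f c) u)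
    (w : EuclideanSpace ℝ (Fin n)) :
    HasDerivAt (fun t : ℝ => (inChart f c (u + t • w)).compContinuousLinearMap
      fun _ => lineTransport c u w t) (nablaInChart f c u w) 0 :=
  hasDerivAt_covTensor (hasDerivAt_inChart_lineTransport_apply hf w)

theorem nabla_curryLeft (f : TensorField n M 𝕜 m) (x : M) (X : TangentSpace (𝓡 n) x) :
    (nabla f x).curryLeft X =
      (nablaInChart f x (extChartAt (𝓡 n) x x) (chartDifferential x X)).compContinuousLinearMap
        fun _ => chartDifferential x := rfl

theorem IsSmoothSymm.isSymm_nablaInChart {f : TensorField n M 𝕜 m} (hf : IsSmoothSymm f) {c : M}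
    {u : EuclideanSpace ℝ (Fin n)} (hu : u ∈ (extChartAt (𝓡 n) c).target)
    (w : EuclideanSpace ℝ (Fin n)) : IsSymm (nablaInChart f c u w) := by
  intro s v
  refine (hasDerivAt_inChart_lineTransport_apply (hf.differentiableAt hu) w (v ∘ s)).unique ?_
  convert! hasDerivAt_inChart_lineTransport_apply (hf.differentiableAt hu) w v using 1
  funext t
  exact isSymm_inChart hf.symm c _ s fun a => lineTransport c u w t (v a)

theorem IsSmoothSymm.isSymm_nabla {f : TensorField n M 𝕜 m} (hf : IsSmoothSymm f) (x : M)
    (X : TangentSpace (𝓡 n) x) : IsSymm ((nabla f x).curryLeft X) :=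
  fun s v => hf.isSymm_nablaInChart (mem_extChartAt_target x) (chartDifferential x X) s
    fun a => chartDifferential x (v a)

theorem IsSmoothSymm.nabla_add {f h : TensorField n M 𝕜 m} (hf : IsSmoothSymm f)
    (hh : IsSmoothSymm h) : nabla (f + h) = nabla f + nabla h := by
  funext x; ext v
  have hf' := hf.differentiableAt (mem_extChartAt_target (I := 𝓡 n) x)
  have hh' := hh.differentiableAt (mem_extChartAt_target (I := 𝓡 n) x)
  simp only [nabla_apply, Pi.add_apply, add_apply, nablaInChart_apply, inChart_add]
  rw [fderiv_add hf' hh']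
  simp only [Finset.sum_add_distrib, add_apply]
  ring

theorem IsSmoothSymm.nabla_smul {f : TensorField n M 𝕜 m} (hf : IsSmoothSymm f) (k : 𝕜) :
    nabla (k • f) = k • nabla f := by
  funext x; ext v
  have hf' := hf.differentiableAt (mem_extChartAt_target (I := 𝓡 n) x)
  simp only [nabla_apply, Pi.smul_apply, smul_apply, nablaInChart_apply, inChart_smul]
  rw [fderiv_const_smul hf']
  simp only [smul_apply, smul_eq_mul, ← Finset.mul_sum]
  ring

theorem IsSmoothSymm.dOp_add {f h : TensorField n M 𝕜 m} (hf : IsSmoothSymm f)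
    (hh : IsSmoothSymm h) : dOp (f + h) = dOp f + dOp h := by
  funext x
  simp only [dOp, hf.nabla_add hh, Pi.add_apply, isLinearMap_symmetrize.map_add]

theorem IsSmoothSymm.dOp_smul {f : TensorField n M 𝕜 m} (hf : IsSmoothSymm f) (k : 𝕜) :
    dOp (k • f) = k • dOp f := by
  funext x
  simp only [dOp, hf.nabla_smul k, Pi.smul_apply, isLinearMap_symmetrize.map_smul]

end CovariantDerivative

section MetricCompatibility

variable {𝕜 : Type*} [RCLike 𝕜] {m n : ℕ} {M : Type*} [TopologicalSpace M]
  [ChartedSpace (EuclideanSpace ℝ (Fin n)) M]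
  [RiemannianBundle (fun x : M => TangentSpace (𝓡 n) x)]

/-- The operator `i` on tensor fields, applied pointwise. -/
def iField (f : TensorField n M 𝕜 m) : TensorField n M 𝕜 (m + 2) := fun x => iOp (f x)

theorem diag_inChart_iField (f : TensorField n M 𝕜 m) (c : M) (u z : EuclideanSpace ℝ (Fin n)) :
    diag (inChart (iField f) c u) z = chartForm c u z z • diag (inChart f c u) z := by
  rw [chartForm_apply, real_inner_self_eq_norm_sq, diag_inChart, diag_inChart]
  exact diag_iOp (f ((extChartAt (𝓡 n) c).symm u)) (coordFrame c u z)

variable [IsManifold (𝓡 n) ∞ M]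

theorem chartForm_self_ne_zero {c : M} {u z : EuclideanSpace ℝ (Fin n)}
    (hu : u ∈ (extChartAt (𝓡 n) c).target) (hz : z ≠ 0) : chartForm c u z z ≠ 0 := by
  rw [chartForm_apply, inner_self_ne_zero]
  exact (map_ne_zero_iff (coordFrame c u) (coordFrame_bijective hu).injective).2 hz

variable [IsContMDiffRiemannianBundle (𝓡 n) ∞ (EuclideanSpace ℝ (Fin n))
  (fun x : M => TangentSpace (𝓡 n) x)]

theorem isSmoothSymm_iField {f : TensorField n M 𝕜 m} (hf : IsSmoothSymm f) :
    IsSmoothSymm (iField f) := by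
  refine isSmoothSymm_of_diag (fun x => isSymm_iOp _) fun c z _ => ?_
  simp only [diag_inChart_iField]
  exact (contDiffOn_chartForm_apply c z z).smul (hf.contDiffOn_diag c z)

theorem IsSmoothSymm.of_iField {f : TensorField n M 𝕜 m} (hf : ∀ x, IsSymm (f x))
    (h : IsSmoothSymm (iField f)) : IsSmoothSymm f := by
  refine isSmoothSymm_of_diag hf fun c z hz => ?_
  have hne (u) (hu : u ∈ (extChartAt (𝓡 n) c).target) := chartForm_self_ne_zero hu hz
  refine (((contDiffOn_chartForm_apply c z z).inv hne).smul (h.contDiffOn_diag c z)).congr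
    fun u hu => ?_
  simp only [Pi.smul_apply', Pi.inv_apply, diag_inChart_iField, inv_smul_smul₀ (hne u hu)]

theorem dOp_iField {f : TensorField n M 𝕜 m} (hf : IsSmoothSymm f) :
    dOp (iField f) = iField (dOp f) := by
  funext x
  refine (isSymm_symmetrize _).ext_diag (isSymm_iOp _) fun X => ?_
  have hu := mem_extChartAt_target (I := 𝓡 n) x
  set w := chartDifferential x X with hw
  have hX : ‖X‖ ^ 2 = chartForm x (extChartAt (𝓡 n) x x) w w := by
    rw [← real_inner_self_eq_norm_sq, ← inner_centerFrame, hw, centerFrame_chartDifferential]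
  have hleft := hasDerivAt_inChart_lineTransport_apply
    ((isSmoothSymm_iField hf).differentiableAt hu) w fun _ => w
  have hright := (hasDerivAt_chartForm_lineTransport hu w w w).smul
    (hasDerivAt_inChart_lineTransport_apply (hf.differentiableAt hu) w fun _ => w)
  have heq := hleft.unique (hright.congr_of_eventuallyEq (.of_forall fun t =>
    diag_inChart_iField f x _ _))
  simp only [iField, diag_iOp, hX]
  simpa [dOp, diag_symmetrize, lineTransport] using! heq

end MetricCompatibility

section TraceFree

variable {𝕜 : Type*} [RCLike 𝕜] {m n : ℕ} {M : Type*} [TopologicalSpace M]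
  [ChartedSpace (EuclideanSpace ℝ (Fin n)) M]
  [RiemannianBundle (fun x : M => TangentSpace (𝓡 n) x)]

/-- The coordinate frame at the point `u + t • w` of the chart around `c`, corrected by the
Christoffel symbols at `u` so that its Gram matrix is constant to first order at `t = 0`. -/
def transportedFrame (c : M) (u w : EuclideanSpace ℝ (Fin n)) (t : ℝ) :
    EuclideanSpace ℝ (Fin n) →L[ℝ] TangentSpace (𝓡 n) ((extChartAt (𝓡 n) c).symm (u + t • w)) :=
  (coordFrame c (u + t • w)).comp (lineTransport c u w t)

theorem inner_gramOperator_transportedFrame (c : M) (u w : EuclideanSpace ℝ (Fin n)) (t : ℝ)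
    (a b : EuclideanSpace ℝ (Fin n)) :
    ⟪gramOperator (transportedFrame c u w t).toLinearMap a, b⟫_ℝ =
      chartForm c (u + t • w) (lineTransport c u w t a) (lineTransport c u w t b) :=
  inner_gramOperator _ a b

theorem gramOperator_transportedFrame_zero (x : M) (w : EuclideanSpace ℝ (Fin n)) :
    gramOperator (transportedFrame x (extChartAt (𝓡 n) x x) w 0).toLinearMap =
      gramOperator (centerFrame (n := n) x).toLinearMap := by
  refine ContinuousLinearMap.ext fun a => ext_inner_right ℝ fun b => ?_
  rw [inner_gramOperator_transportedFrame, inner_gramOperator]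
  simpa [lineTransport] using! (inner_centerFrame x a b).symm

variable [IsManifold (𝓡 n) ∞ M]

variable [IsContMDiffRiemannianBundle (𝓡 n) ∞ (EuclideanSpace ℝ (Fin n))
  (fun x : M => TangentSpace (𝓡 n) x)]

theorem hasDerivAt_gramOperator_transportedFrame {c : M} {u : EuclideanSpace ℝ (Fin n)}
    (hu : u ∈ (extChartAt (𝓡 n) c).target) (w : EuclideanSpace ℝ (Fin n)) :
    HasDerivAt (fun t => gramOperator (transportedFrame c u w t).toLinearMap) 0 0 := by
  let ℓ (ab : EuclideanSpace ℝ (Fin n) × EuclideanSpace ℝ (Fin n)) :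
      (EuclideanSpace ℝ (Fin n) →L[ℝ] EuclideanSpace ℝ (Fin n)) →ₗ[ℝ] ℝ :=
    ((innerSL ℝ ab.2).comp (ContinuousLinearMap.apply ℝ _ ab.1)).toLinearMap
  have hℓ (ab) (H) : ℓ ab H = ⟪H ab.1, ab.2⟫_ℝ :=
    real_inner_comm (H ab.1) ab.2
  refine hasDerivAt_of_separating (ℓ := ℓ) (fun H hH => ?_) fun ab => ?_
  · exact ContinuousLinearMap.ext fun a => ext_inner_right ℝ fun b => by
      rw [← hℓ (a, b), hH]; exact (inner_zero_left b).symm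
  · simp only [hℓ, inner_gramOperator_transportedFrame, zero_apply, inner_zero_left]
    exact hasDerivAt_chartForm_lineTransport hu w ab.1 ab.2

theorem eventually_bijective_transportedFrame (x : M) (w : EuclideanSpace ℝ (Fin n)) :
    ∀ᶠ t in nhds 0, Function.Bijective (transportedFrame x (extChartAt (𝓡 n) x x) w t) := by
  have hcont :=
    (hasDerivAt_gramOperator_transportedFrame (mem_extChartAt_target x) w).continuousAt
  have hunit : IsUnit (gramOperator
      (transportedFrame x (extChartAt (𝓡 n) x x) w 0).toLinearMap) := by
    rw [gramOperator_transportedFrame_zero, isUnit_gramOperator_iff]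
    exact (centerFrame_bijective x).injective
  filter_upwards [hcont.eventually (Units.isOpen.mem_nhds hunit)] with t ht
  have hinj := isUnit_gramOperator_iff.1 ht
  exact ⟨hinj, (LinearMap.injective_iff_surjective_of_finrank_eq_finrank rfl).1 hinj⟩

theorem jOp_compFirst_nablaInChart_eq_zero {f : TensorField n M 𝕜 (m + 2)} (hf : IsSmoothSymm f)
    (htrace : ∀ x, jOp (f x) = 0) (x : M) (w : EuclideanSpace ℝ (Fin n)) :
    jOp (compFirst (Ring.inverse (gramOperator (centerFrame (n := n) x).toLinearMap))
      (nablaInChart f x (extChartAt (𝓡 n) x x) w)) = 0 := by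
  have hu := mem_extChartAt_target (I := 𝓡 n) x
  have hunit := isUnit_gramOperator_iff.2 (eventually_bijective_transportedFrame x w).self_of_nhds.1
  have hderiv := hasDerivAt_jOp_compFirst
    (hasDerivAt_ringInverse_zero (hasDerivAt_gramOperator_transportedFrame hu w) hunit)
    (hasDerivAt_inChart_lineTransport (hf.differentiableAt hu) w)
  rw [gramOperator_transportedFrame_zero] at hderiv
  refine hderiv.unique ((hasDerivAt_const (0 : ℝ)
    (0 : CovTensor 𝕜 m (EuclideanSpace ℝ (Fin n)))).congr_of_eventuallyEq ?_)
  filter_upwards [eventually_bijective_transportedFrame x w] with t ht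
  refine (jOp_compFirst_inverse_gramOperator ht (f _)).trans ?_
  rw [htrace]
  rfl

theorem IsSmoothTraceFree.nabla_curryLeft_mem_kerJ {f : TensorField n M 𝕜 m}
    (hf : IsSmoothTraceFree f) (x : M) (X : TangentSpace (𝓡 n) x) :
    (nabla f x).curryLeft X ∈ kerJ 𝕜 m (TangentSpace (𝓡 n) x) := by
  refine ⟨hf.1.isSymm_nabla x X, ?_⟩
  match m, f, hf with
  | 0, _, _ => trivial
  | 1, _, _ => trivial
  | m + 2, f, hf =>
    have hframe : ((nabla f x).curryLeft X).compContinuousLinearMap (fun _ => centerFrame x) =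
        nablaInChart f x (extChartAt (𝓡 n) x x) (chartDifferential x X) := by
      ext v
      simp [nabla_curryLeft, chartDifferential_centerFrame]
    have hjOp := jOp_compFirst_inverse_gramOperator (V := TangentSpace (𝓡 n) x)
      (P := centerFrame (n := n) x) (centerFrame_bijective x) ((nabla f x).curryLeft X)
    rw [hframe, jOp_compFirst_nablaInChart_eq_zero hf.1 hf.2] at hjOp
    refine ContinuousMultilinearMap.ext fun v => ?_
    obtain ⟨a, rfl⟩ : ∃ a, (fun i => centerFrame x (a i)) = v :=
      ⟨fun i => chartDifferential x (v i), funext fun i => centerFrame_chartDifferential x _⟩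
    exact (DFunLike.congr_fun hjOp a).symm

end TraceFree

section HigherHarmonics

variable {𝕜 : Type*} [RCLike 𝕜] {m n : ℕ} {M : Type*} [TopologicalSpace M]
  [ChartedSpace (EuclideanSpace ℝ (Fin n)) M]
  [RiemannianBundle (fun x : M => TangentSpace (𝓡 n) x)]

theorem isLinearMap_iField :
    IsLinearMap 𝕜 (iField : TensorField n M 𝕜 m → TensorField n M 𝕜 (m + 2)) where
  map_add f h := funext fun x => isLinearMap_iOp.map_add (f x) (h x)
  map_smul c f := funext fun x => isLinearMap_iOp.map_smul c (f x)

theorem iField_inj {f h : TensorField n M 𝕜 (m + 1)} (hf : ∀ x, IsSymm (f x))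
    (hh : ∀ x, IsSymm (h x)) : iField f = iField h ↔ f = h := by
  refine ⟨fun heq => funext fun x => ?_, congrArg iField⟩
  have hsymm : IsSymm (f x - h x) := (symTensor 𝕜 _ _).sub_mem (hf x) (hh x)
  exact sub_eq_zero.1 (hsymm.eq_zero_of_iOp_eq_zero
    ((iOp_sub _ _).trans (sub_eq_zero.2 (congrFun heq x))))

theorem higherHarmonic_of_mem_kerJ {f : TensorField n M 𝕜 m}
    (hf : ∀ x, f x ∈ kerJ 𝕜 m (TangentSpace (𝓡 n) x)) : higherHarmonic f = f :=
  funext fun x => pOp_of_mem (hf x)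

theorem IsSmoothTraceFree.higherHarmonic_eq {f : TensorField n M 𝕜 m}
    (hf : IsSmoothTraceFree f) : higherHarmonic f = f :=
  higherHarmonic_of_mem_kerJ fun x => ⟨hf.1.symm x, hf.2 x⟩

theorem higherHarmonic_add_iField {f : TensorField n M 𝕜 (m + 2)} (hf : ∀ x, IsSymm (f x))
    (v : TensorField n M 𝕜 m) : higherHarmonic (f + iField v) = higherHarmonic f := by
  funext x
  obtain ⟨w, -, hw⟩ := (hf x).exists_eq_pOp_add_iOp
  have hsum : f x + iOp (v x) = pOp (f x) + iOp (w + v x) := by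
    rw [isLinearMap_iOp.map_add, ← add_assoc, ← hw]
  exact (congrArg pOp hsum).trans (pOp_add_iOp (pOp_mem _) _)

theorem higherHarmonic_iField (v : TensorField n M 𝕜 m) : higherHarmonic (iField v) = 0 :=
  funext fun x => pOp_iOp (v x)

theorem higherHarmonic_of_lt_two {f : TensorField n M 𝕜 m} (hf : ∀ x, IsSymm (f x)) (hm : m < 2) :
    higherHarmonic f = f :=
  match m, hm with
  | 0, _ => higherHarmonic_of_mem_kerJ fun x => ⟨hf x, trivial⟩
  | 1, _ => higherHarmonic_of_mem_kerJ fun x => ⟨hf x, trivial⟩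

theorem IsKilling.isKilling_and_higherHarmonic_eq_iff_of_lt_two {f : TensorField n M 𝕜 m}
    (hf : IsKilling f) (h : TensorField n M 𝕜 m) (hm : m < 2) :
    (IsKilling h ∧ higherHarmonic h = higherHarmonic f) ↔ h - f = 0 := by
  rw [sub_eq_zero, higherHarmonic_of_lt_two hf.1.symm hm]
  constructor
  · rintro ⟨hh, heq⟩
    rwa [higherHarmonic_of_lt_two hh.1.symm hm] at heq
  · rintro rfl
    exact ⟨hf, higherHarmonic_of_lt_two hf.1.symm hm⟩

theorem IsSmoothTraceFree.exists_isKilling_iff_of_lt_two {f : TensorField n M 𝕜 m}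
    (hf : IsSmoothTraceFree f) (hm : m < 2) :
    (∃ F : TensorField n M 𝕜 m, IsKilling F ∧ higherHarmonic F = f) ↔ dOp f = 0 := by
  refine ⟨?_, fun h => ⟨f, ⟨hf.1, h⟩, hf.higherHarmonic_eq⟩⟩
  rintro ⟨F, hF, hFf⟩
  rw [← hFf, higherHarmonic_of_lt_two hF.1.symm hm]
  exact hF.2

/-- The constant `c` for which the trace-free part of `df` is `df - c • iδf` whenever `f` is
trace-free of rank `m + 2` in dimension `n`. -/
def divCoeff (𝕜 : Type*) [RCLike 𝕜] (n m : ℕ) : 𝕜 := (m + 2) / (n + 2 * (m + 1))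

theorem divCoeff_ne_zero (n m : ℕ) : divCoeff 𝕜 n m ≠ 0 :=
  div_ne_zero (by exact_mod_cast (by lia : m + 2 ≠ 0))
    (by exact_mod_cast (by lia : n + 2 * (m + 1) ≠ 0))

variable [IsManifold (𝓡 n) ∞ M] [IsContMDiffRiemannianBundle (𝓡 n) ∞ (EuclideanSpace ℝ (Fin n))
  (fun x : M => TangentSpace (𝓡 n) x)]

theorem dOp_add_iField {f : TensorField n M 𝕜 (m + 2)} (hf : IsSmoothSymm f)
    {v : TensorField n M 𝕜 m} (hv : IsSmoothSymm v) :
    dOp (f + iField v) = dOp f + iField (dOp v) := by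
  rw [hf.dOp_add (isSmoothSymm_iField hv), dOp_iField hv]

theorem IsSmoothSymm.higherHarmonic_eq_iff {f h : TensorField n M 𝕜 (m + 2)}
    (hf : IsSmoothSymm f) (hh : IsSmoothSymm h) :
    higherHarmonic h = higherHarmonic f ↔
      ∃ v : TensorField n M 𝕜 m, IsSmoothSymm v ∧ h = f + iField v := by
  refine ⟨fun heq => ?_, ?_⟩
  · choose vh hvh hvh_eq using fun x => (hh.symm x).exists_eq_pOp_add_iOp
    choose vf hvf hvf_eq using fun x => (hf.symm x).exists_eq_pOp_add_iOp
    have hdiff : iField (fun x => vh x - vf x) = h - f := by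
      funext x
      have hp : pOp (h x) = pOp (f x) := congrFun heq x
      rw [iField, iOp_sub, Pi.sub_apply, hvh_eq x, hvf_eq x, hp]
      abel
    refine ⟨fun x => vh x - vf x, .of_iField
      (fun x => (symTensor 𝕜 m _).sub_mem (hvh x) (hvf x)) ?_, ?_⟩
    · rw [hdiff]
      exact hh.sub hf
    · rw [hdiff, add_sub_cancel]
  · rintro ⟨v, -, rfl⟩
    exact higherHarmonic_add_iField hf.symm v

theorem IsKilling.add_iField_iff {f : TensorField n M 𝕜 (m + 2)} (hf : IsKilling f)
    {v : TensorField n M 𝕜 m} (hv : IsSmoothSymm v) : IsKilling (f + iField v) ↔ IsKilling v := by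
  have hzero : iField (dOp v) = 0 ↔ dOp v = 0 := by
    rw [← isLinearMap_iField.map_zero]
    exact iField_inj (fun x => isSymm_symmetrize _) fun x => (symTensor 𝕜 _ _).zero_mem
  rw [IsKilling, dOp_add_iField hf.1 hv, hf.2, zero_add, hzero]
  exact and_congr_left fun _ => iff_of_true (hf.1.add (isSmoothSymm_iField hv)) hv

theorem IsKilling.isKilling_and_higherHarmonic_eq_iff {f : TensorField n M 𝕜 m}
    (hf : IsKilling f) (h : TensorField n M 𝕜 m) :
    (IsKilling h ∧ higherHarmonic h = higherHarmonic f) ↔ IsMetricTimesKilling (h - f) := by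
  match m, f, hf, h with
  | 0, f, hf, h => exact IsKilling.isKilling_and_higherHarmonic_eq_iff_of_lt_two hf h (by norm_num)
  | 1, f, hf, h => exact IsKilling.isKilling_and_higherHarmonic_eq_iff_of_lt_two hf h (by norm_num)
  | m + 2, f, hf, h =>
    constructor
    · rintro ⟨hh, heq⟩
      obtain ⟨v, hv, rfl⟩ := (hf.1.higherHarmonic_eq_iff hh.1).1 heq
      exact ⟨v, (hf.add_iField_iff hv).1 hh, add_sub_cancel_left _ _⟩
    · rintro ⟨v, hv, hhf⟩
      obtain rfl : h = f + iField v := eq_add_of_sub_eq' hhf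
      exact ⟨(hf.add_iField_iff hv.1).2 hv, higherHarmonic_add_iField hf.1.symm v⟩

theorem IsSmoothTraceFree.isSymm_divergence {f : TensorField n M 𝕜 (m + 1)}
    (hf : IsSmoothTraceFree f) (x : M) : IsSymm (divergence f x) :=
  (jOp_mem_kerJ (hf.nabla_curryLeft_mem_kerJ x)).1

theorem IsSmoothTraceFree.higherHarmonic_dOp_eq_zero_iff {f : TensorField n M 𝕜 (m + 1)}
    (hn : n + 2 * m ≠ 0) (hf : IsSmoothTraceFree f) :
    higherHarmonic (dOp f) = 0 ↔
      dOp f = ((m + 1 : 𝕜) / (n + 2 * m)) • iField (divergence f) := by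
  rw [funext_iff, funext_iff]
  refine forall_congr' fun x => ?_
  have hfinrank : Module.finrank ℝ (TangentSpace (𝓡 n) x) = n := finrank_euclideanSpace_fin
  have h := pOp_symmetrize_eq_zero_iff (by rwa [hfinrank]) (hf.nabla_curryLeft_mem_kerJ x)
  rw [hfinrank, isLinearMap_iOp.map_smul] at h
  exact h

theorem IsSmoothTraceFree.dOp_eq_zero_iff {f : TensorField n M 𝕜 1} (hf : IsSmoothTraceFree f) :
    dOp f = 0 ↔ higherHarmonic (dOp f) = 0 ∧ divergence f = 0 := by
  have hjOp (x : M) : jOp (dOp f x) = divergence f x := by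
    have h := smul_jOp_symmetrize (hf.nabla_curryLeft_mem_kerJ x)
    simp only [← Nat.cast_smul_eq_nsmul 𝕜] at h
    exact smul_right_injective _ (by norm_num) h
  constructor
  · intro h
    refine ⟨by rw [h]; exact higherHarmonic_of_mem_kerJ fun x => zero_mem _, funext fun x => ?_⟩
    rw [← hjOp, h]
    exact Finset.sum_const_zero
  · rintro ⟨hp, hδ⟩
    exact funext fun x => (isSymm_symmetrize _).eq_zero_of_pOp_of_jOp (congrFun hp x)
      ((hjOp x).trans (congrFun hδ x))

theorem IsSmoothTraceFree.dOp_add_iField_eq_zero_iff {f : TensorField n M 𝕜 (m + 2)}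
    (hf : IsSmoothTraceFree f) {v : TensorField n M 𝕜 m} (hv : IsSmoothSymm v) :
    dOp (f + iField (-divCoeff 𝕜 n m • v)) = 0 ↔
      higherHarmonic (dOp f) = 0 ∧ divergence f = dOp v := by
  have hpd : higherHarmonic (dOp f) = 0 ↔ dOp f = divCoeff 𝕜 n m • iField (divergence f) := by
    rw [hf.higherHarmonic_dOp_eq_zero_iff (by lia), divCoeff]
    push_cast
    norm_num [add_assoc]
  have hdF : dOp (f + iField (-divCoeff 𝕜 n m • v)) = 0 ↔
      dOp f = divCoeff 𝕜 n m • iField (dOp v) := by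
    rw [dOp_add_iField hf.1 (hv.smul _), hv.dOp_smul, isLinearMap_iField.map_smul, neg_smul,
      add_neg_eq_zero]
  rw [hdF]
  constructor
  · intro h
    have hpd0 : higherHarmonic (dOp f) = 0 := by
      rw [h, ← isLinearMap_iField.map_smul, higherHarmonic_iField]
    refine ⟨hpd0, (iField_inj hf.isSymm_divergence fun x => isSymm_symmetrize _).1 ?_⟩
    exact smul_right_injective _ (divCoeff_ne_zero n m) ((hpd.1 hpd0).symm.trans h)
  · rintro ⟨hpd0, hδ⟩
    rw [hpd.1 hpd0, hδ]

theorem IsSmoothTraceFree.exists_isKilling_iff_isPotential {f : TensorField n M 𝕜 (m + 2)}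
    (hf : IsSmoothTraceFree f) :
    (∃ F : TensorField n M 𝕜 (m + 2), IsKilling F ∧ higherHarmonic F = f) ↔
      higherHarmonic (dOp f) = 0 ∧ IsPotential (divergence f) := by
  constructor
  · rintro ⟨F, hF, hFf⟩
    obtain ⟨w, hw, rfl⟩ := (hf.1.higherHarmonic_eq_iff hF.1).1 (hFf.trans hf.higherHarmonic_eq.symm)
    obtain ⟨v, hv, rfl⟩ : ∃ v, IsSmoothSymm v ∧ -divCoeff 𝕜 n m • v = w :=
      ⟨(-divCoeff 𝕜 n m)⁻¹ • w, hw.smul _, smul_inv_smul₀ (neg_ne_zero.2 (divCoeff_ne_zero n m)) w⟩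
    obtain ⟨hpd, hδ⟩ := (hf.dOp_add_iField_eq_zero_iff hv).1 hF.2
    exact ⟨hpd, v, hv, hδ⟩
  · rintro ⟨hpd, v, hv, hδ⟩
    refine ⟨f + iField (-divCoeff 𝕜 n m • v), ⟨hf.1.add (isSmoothSymm_iField (hv.smul _)), ?_⟩, ?_⟩
    · exact (hf.dOp_add_iField_eq_zero_iff hv).2 ⟨hpd, hδ⟩
    · rw [higherHarmonic_add_iField hf.1.symm, hf.higherHarmonic_eq]

theorem IsSmoothTraceFree.exists_isKilling_iff {f : TensorField n M 𝕜 m}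
    (hf : IsSmoothTraceFree f) :
    (∃ F : TensorField n M 𝕜 m, IsKilling F ∧ higherHarmonic F = f) ↔
      higherHarmonic (dOp f) = 0 ∧ HasPotentialDivergence f := by
  match m, f, hf with
  | 0, f, hf =>
    have hpd : higherHarmonic (dOp f) = dOp f :=
      higherHarmonic_of_lt_two (fun x => isSymm_symmetrize _) (by norm_num)
    rw [hf.exists_isKilling_iff_of_lt_two (by norm_num), hpd]
    exact (and_iff_left trivial).symm
  | 1, f, hf => exact (hf.exists_isKilling_iff_of_lt_two (by norm_num)).trans hf.dOp_eq_zero_iff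
  | m + 2, f, hf => exact hf.exists_isKilling_iff_isPotential

end HigherHarmonics

end KillingTensor

end

open KillingTensor in
theorem mainTheorem2_general {𝕜 : Type*} [RCLike 𝕜] {n : ℕ} {M : Type*} [TopologicalSpace M]
    [ChartedSpace (EuclideanSpace ℝ (Fin n)) M] [IsManifold (𝓡 n) ∞ M]
    [RiemannianBundle (fun x : M => TangentSpace (𝓡 n) x)]
    [IsContMDiffRiemannianBundle (𝓡 n) ∞ (EuclideanSpace ℝ (Fin n))
      (fun x : M => TangentSpace (𝓡 n) x)] (m : ℕ) :
    (∀ f h : TensorField n M 𝕜 m, IsKilling f →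
      ((IsKilling h ∧ higherHarmonic h = higherHarmonic f) ↔ IsMetricTimesKilling (h - f))) ∧
    (∀ f : TensorField n M 𝕜 m, IsSmoothTraceFree f →
      ((∃ F : TensorField n M 𝕜 m, IsKilling F ∧ higherHarmonic F = f) ↔
        higherHarmonic (dOp f) = 0 ∧ HasPotentialDivergence f)) :=
  ⟨fun _ h hf => IsKilling.isKilling_and_higherHarmonic_eq_iff hf h,
    fun _ hf => hf.exists_isKilling_iff⟩

open KillingTensor in
theorem mainTheorem2 {𝕜 : Type*} [RCLike 𝕜] {n : ℕ} {M : Type*} [TopologicalSpace M]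
    [T2Space M] [CompactSpace M] [ChartedSpace (EuclideanSpace ℝ (Fin n)) M]
    [IsManifold (𝓡 n) ∞ M] [RiemannianBundle (fun x : M => TangentSpace (𝓡 n) x)]
    [IsContMDiffRiemannianBundle (𝓡 n) ∞ (EuclideanSpace ℝ (Fin n))
      (fun x : M => TangentSpace (𝓡 n) x)] (m : ℕ) :
    (∀ f h : TensorField n M 𝕜 m, IsKilling f →
      ((IsKilling h ∧ higherHarmonic h = higherHarmonic f) ↔ IsMetricTimesKilling (h - f))) ∧
    (∀ f : TensorField n M 𝕜 m, IsSmoothTraceFree f →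
      ((∃ F : TensorField n M 𝕜 m, IsKilling F ∧ higherHarmonic F = f) ↔
        higherHarmonic (dOp f) = 0 ∧ HasPotentialDivergence f)) :=
  mainTheorem2_general m
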